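/- Let $V_{\mathbb Z}$ be a free $\mathbb Z$-module of rank $n+1$ ($n\ge 0$) with an integer-valued, not necessarily unimodular, quadratic form $q$ of signature $(1,n)$, let $O(V_{\mathbb Z})$ be its group of isometries, and let $\Gamma\subset O(V_{\mathbb Z})$ be a subgroup of finite index. Put $V=V_{\mathbb Z}\otimes_{\mathbb Z}\mathbb R$ and let $\mathbb H=\mathbb P V^+$ be the $n$-dimensional hyperbolic space, that is, the projectivization of the set $V^+=\{v\in V : q(v)>0\}$. Let $S_0\subset V_{\mathbb Z}$ be a finite set of vectors with $q(s)<0$, let $S=\Gamma\cdot S_0$, and for $s\in S$ let $s^\perp\subset V$ be its orthogonal complement. For $0\le d\le n$, call a subset $S_d\subset\mathbb H$ a $d$-dimensional stratum if $S_d=\mathbb H\cap\mathbb P(s_1^\perp\cap\dots\cap s_{n-d}^\perp)$ for some linearly independent $s_1,\dots,s_{n-d}\in S$ (so that $S_n=\mathbb H$; there are no strata of dimension $-1$). A $d$-dimensional face of the tessellation of $\mathbb H$ cut out by the hyperplanes $s^\perp$, $s\in S$, is a connected component of the complement, in some $d$-dimensional stratum, of the union of all $(d-1)$-dimensional strata.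 In particular, the $n$-dimensional faces are the connected components of $\mathbb H\setminus\bigcup_{s\in S}\mathbb P(s^\perp)$. Then, for every $d$, the group $\Gamma$ maps $d$-dimensional faces to $d$-dimensional faces, and it acts on the set of all $d$-dimensional faces with finitely many orbits. -/

import Mathlib

open scoped TensorProduct LinearAlgebra.Projectivization

noncomputable section

namespace HypTess

variable {L : Type*} [AddCommGroup L]

/-- The orthogonal group `O(L, q)` of an integral quadratic form: all `ℤ`-linear automorphisms of
`L` that preserve `q`. -/
def orthogonalGroup (q : QuadraticForm ℤ L) : Subgroup (L ≃ₗ[ℤ] L) where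
  carrier := {g | ∀ v, q (g v) = q v}
  one_mem' := fun _ => rfl
  mul_mem' := by
    intro a b ha hb v
    rw [LinearEquiv.mul_apply, ha, hb]
  inv_mem' := by
    intro a ha v
    rw [← ha (a⁻¹ v), ← LinearEquiv.mul_apply, mul_inv_cancel, LinearEquiv.coe_one, id]

variable (L) in
/-- The real vector space `V = L ⊗ ℝ`. -/
abbrev RealSpace : Type _ := ℝ ⊗[ℤ] L

/-- The real bilinear form extending the polar form `q (x + y) - q x - q y` of `q`. -/
def realBilin (q : QuadraticForm ℤ L) : LinearMap.BilinForm ℝ (RealSpace L) :=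
  LinearMap.BilinForm.baseChange ℝ q.polarBilin

/-- The real quadratic form on `V = L ⊗ ℝ` extending `q`. -/
def realForm (q : QuadraticForm ℤ L) : QuadraticForm ℝ (RealSpace L) :=
  (2⁻¹ : ℝ) • (realBilin q).toQuadraticMap

theorem realForm_tmul (q : QuadraticForm ℤ L) (a : ℝ) (v : L) :
    realForm q (a ⊗ₜ[ℤ] v) = a ^ 2 * (q v : ℝ) := by
  simp [realForm, realBilin, LinearMap.BilinForm.baseChange_tmul]
  ring

theorem polar_realForm (q : QuadraticForm ℤ L) (x y : RealSpace L) :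
    QuadraticMap.polar (realForm q) x y = realBilin q x y := by
  have h : realBilin q y x = realBilin q x y := by
    simpa [realBilin] using (LinearMap.BilinForm.IsSymm.baseChange ℝ (B₂ := q.polarBilin)
      ⟨fun a b => QuadraticMap.polar_comm _ _ _⟩).eq y x
  simp [QuadraticMap.polar, realForm, h]
  ring

/-- `q` has signature `(a, b)`; in particular it is nondegenerate and `L` has rank `a + b`. -/
def HasSignature (q : QuadraticForm ℤ L) (a b : ℕ) : Prop :=
  Module.finrank ℤ L = a + b ∧ sigPos (realForm q) = a ∧ sigNeg (realForm q) = b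

/-- The standard topology of the finite-dimensional real vector space `V`. -/
instance : TopologicalSpace (RealSpace L) := moduleTopology ℝ (RealSpace L)

/-- The quotient topology on the projective space of `V`. -/
instance : TopologicalSpace (ℙ ℝ (RealSpace L)) :=
  TopologicalSpace.coinduced
    (fun v : {v : RealSpace L // v ≠ 0} => Projectivization.mk ℝ v.1 v.2) inferInstance

/-- The hyperbolic space `ℍ = ℙ V⁺`: the lines spanned by vectors of positive square. -/
def hyperbolicSpace (q : QuadraticForm ℤ L) : Set (ℙ ℝ (RealSpace L)) :=
  {p | 0 < realForm q p.rep}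

/-- The part `ℍ ∩ ℙ W` of the hyperbolic space lying on a linear subspace `W` of `V`. -/
def hypSubspace (q : QuadraticForm ℤ L) (W : Submodule ℝ (RealSpace L)) :
    Set (ℙ ℝ (RealSpace L)) :=
  {p | p ∈ hyperbolicSpace q ∧ p.rep ∈ W}

/-- The hyperplane `s^⊥` in `V`. -/
def perp (q : QuadraticForm ℤ L) (s : L) : Submodule ℝ (RealSpace L) :=
  LinearMap.ker (realBilin q ((1 : ℝ) ⊗ₜ[ℤ] s))

/-- The intersections of `k` transversal hyperplanes `s₁^⊥, …, s_k^⊥` with all `s_i ∈ S`, where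
transversality means that the normal vectors are linearly independent. -/
def flats (q : QuadraticForm ℤ L) (S : Set L) (k : ℕ) : Set (Submodule ℝ (RealSpace L)) :=
  {W | ∃ s : Fin k → L, (∀ i, s i ∈ S) ∧
    LinearIndependent ℝ (fun i => ((1 : ℝ) ⊗ₜ[ℤ] s i : RealSpace L)) ∧
    W = ⨅ i, perp q (s i)}

/-- The `d`-dimensional faces of the tessellation of the `n`-dimensional hyperbolic space cut out
by the hyperplanes `s^⊥`, `s ∈ S`: the connected components of `S_d` minus the union of all
`S_{d-1}`, where `S_d` is an intersection in `ℍ` of `k = n - d` transversal hyperplanes and the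
`S_{d-1}` are the intersections of `k + 1` transversal ones. For `d = n` these are the
components of `ℍ` minus all the hyperplanes. -/
def faces (q : QuadraticForm ℤ L) (S : Set L) (n d : ℕ) : Set (Set (ℙ ℝ (RealSpace L))) :=
  {F | ∃ k, k + d = n ∧ ∃ W ∈ flats q S k,
    ∃ x ∈ hypSubspace q W \ ⋃ W' ∈ flats q S (k + 1), hypSubspace q W',
      F = connectedComponentIn
        (hypSubspace q W \ ⋃ W' ∈ flats q S (k + 1), hypSubspace q W') x}

/-- The projective transformation of `ℙ V` induced by an automorphism of `L`. -/
def projAct (g : L ≃ₗ[ℤ] L) : ℙ ℝ (RealSpace L) → ℙ ℝ (RealSpace L) :=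
  Projectivization.map (LinearEquiv.baseChange ℤ ℝ L L g).toLinearMap
    (LinearEquiv.baseChange ℤ ℝ L L g).injective

/-- The orbit `Γ · S₀` of a set of vectors. -/
def orbitSet {q : QuadraticForm ℤ L} (Γ : Subgroup (orthogonalGroup q)) (S₀ : Set L) : Set L :=
  {s | ∃ γ ∈ Γ, ∃ s₀ ∈ S₀, s = (γ : L ≃ₗ[ℤ] L) s₀}

end HypTess

end

/-! Call two vectors of positive square equivalent (`SameCell`) if they lie in the same half of the
light cone and every `s ∈ S` has the same sign, possibly zero, on both. The classes project to
connected subsets of `ℍ`, and a connectedness argument shows that these cells are exactly the faces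
(`connectedComponentIn_openStratum`); the dimension is read off from the rank of the normals
vanishing on the cell. It therefore suffices to find finitely many `Γ`-orbits of cells of all
dimensions at once (`exists_finite_cells`), by induction from large rank of the normals to small
rank.

A cell may fill a whole stratum (within one half of the cone). Independent normals `s₁, …, s_k` of
that stratum lie in a negative definite space, and their squares are bounded below because squares
are constant on orbits and `S₀` is finite. By Cauchy–Schwarz their Gram matrix is bounded, and such
tuples form finitely many `Γ`-orbits (`exists_finite_tuples`). This is the arithmetic input:
orthogonal complements have bounded discriminant, hence by Minkowski a nonisotropic vector of
bounded square, so the tuple extends to one of full rank with bounded Gram matrix. A full-rank tuple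
is determined up to isometry by its Gram matrix and the image of the lattice under pairing with it,
and there are finitely many such pairs.

Any other cell has a boundary point on a smaller stratum, namely the first hyperplane hit by a
suitable segment (`exists_boundary_point`). By induction that point lies in one of finitely many
cells up to `Γ`, and by local finiteness only finitely many cells have a given point in their
closure (`exists_finite_star`). -/

namespace HypTess

/-! ### Geometry of numbers. -/

open Matrix MeasureTheory in
/-- **Minkowski's theorem on linear forms.** -/
theorem exists_int_vec_linear_forms_le {ι : Type*} [Fintype ι] [DecidableEq ι]
    (P : Matrix ι ι ℝ) (hP : P.det ≠ 0) (c : ℝ) (hc : 0 ≤ c)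
    (hPc : |P.det| < c ^ Fintype.card ι) :
    ∃ z : ι → ℤ, z ≠ 0 ∧ ∀ i, |(P *ᵥ fun j => (z j : ℝ)) i| ≤ c := by
  let b := Pi.basisFun ℝ ι
  let s : Set (ι → ℝ) := Matrix.toLin' P ⁻¹' Metric.closedBall 0 c
  have hdet : LinearMap.det (Matrix.toLin' P) ≠ 0 := by rwa [LinearMap.det_toLin']
  have hvol : volume (ZSpan.fundamentalDomain b) * 2 ^ Module.finrank ℝ (ι → ℝ) < volume s := by
    have h1 : (Matrix.of b) = (1 : Matrix ι ι ℝ) := by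
      ext i j
      simp [b, Matrix.one_apply, Pi.single_apply, eq_comm]
    rw [ZSpan.volume_fundamentalDomain, h1,
      Measure.addHaar_preimage_linearMap _ hdet, LinearMap.det_toLin',
      Real.volume_pi_closedBall _ hc, ← ENNReal.ofReal_mul (abs_nonneg _)]
    have h2 : (2 : ENNReal) ^ Module.finrank ℝ (ι → ℝ)
        = ENNReal.ofReal (2 ^ Fintype.card ι) := by
      rw [Module.finrank_pi, ENNReal.ofReal_pow (by norm_num)]
      simp
    have h3 : 0 < |P.det| := abs_pos.mpr hP
    rw [h2, Matrix.det_one, abs_one, ENNReal.ofReal_one, one_mul]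
    refine ENNReal.ofReal_lt_ofReal_iff'.mpr ⟨?_, ?_⟩
    · rw [abs_inv, mul_pow, inv_mul_eq_div, lt_div_iff₀ h3]
      exact mul_lt_mul_of_pos_left hPc (by positivity)
    · rw [abs_inv, mul_pow]
      have : 0 < c ^ Fintype.card ι := h3.trans hPc
      positivity
  have : Countable (Submodule.span ℤ (Set.range b)).toAddSubgroup :=
    inferInstanceAs (Countable (Submodule.span ℤ (Set.range b)))
  obtain ⟨x, hx0, hxs⟩ := exists_ne_zero_mem_lattice_of_measure_mul_two_pow_lt_measure
    (ZSpan.isAddFundamentalDomain' b volume)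
    (fun x hx => by simpa [s, Matrix.mulVec_neg] using hx)
    ((convex_closedBall (0 : ι → ℝ) c).linear_preimage (Matrix.toLin' P)) hvol
  obtain ⟨z, hz⟩ := (Submodule.mem_span_range_iff_exists_fun ℤ).mp x.2
  have hxz : (x : ι → ℝ) = fun j => (z j : ℝ) := by
    rw [← hz]
    ext j
    simp [b, Finset.sum_apply, Pi.single_apply]
  refine ⟨z, fun h => hx0 ?_, fun i => ?_⟩
  · apply Subtype.ext
    rw [hxz, h]
    ext
    simp
  · have := hxs
    simp only [Set.mem_preimage, Matrix.toLin'_apply, mem_closedBall_zero_iff, hxz] at this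
    exact (norm_le_pi_norm _ i).trans this

open Matrix in
/-- A nondegenerate real symmetric form takes a small value at some nonzero integral vector. -/
theorem exists_int_vec_form_le {ι : Type*} [Fintype ι] [DecidableEq ι] [Nonempty ι]
    (G : Matrix ι ι ℝ) (hG : G.IsHermitian) (hdet : G.det ≠ 0) :
    ∃ z : ι → ℤ, z ≠ 0 ∧
      |(fun j => (z j : ℝ)) ⬝ᵥ G *ᵥ (fun j => (z j : ℝ))|
        ≤ Fintype.card ι * (|G.det| + 1) ^ 2 := by
  let U : Matrix ι ι ℝ := hG.eigenvectorUnitary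
  let l : ι → ℝ := hG.eigenvalues
  have hU : U * star U = 1 := Unitary.coe_mul_star_self hG.eigenvectorUnitary
  have hGU : G = U * diagonal l * star U := by
    have := hG.spectral_theorem
    rw [Unitary.conjStarAlgAut_apply] at this
    exact this
  -- In the coordinates `P x` the form becomes a sum of squares with signs, so small coordinates
  -- force a small value.
  let P : Matrix ι ι ℝ := diagonal (fun i => √|l i|) * star U
  have hdetU : |(star U).det| = 1 := by
    have h := congrArg Matrix.det hU
    rw [det_mul, det_one, star_eq_conjTranspose, det_conjTranspose, star_trivial] at h
    rw [star_eq_conjTranspose, det_conjTranspose, star_trivial]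
    rw [← abs_one, ← h, abs_mul, ← sq, sq_abs]
    nlinarith [abs_nonneg U.det, sq_abs U.det]
  have hdetG : |G.det| = ∏ i, |l i| := by
    rw [hG.det_eq_prod_eigenvalues, Finset.abs_prod]
    rfl
  have hdetP : |P.det| = ∏ i, √|l i| := by
    rw [det_mul, abs_mul, hdetU, mul_one, det_diagonal, Finset.abs_prod]
    exact Finset.prod_congr rfl fun i _ => abs_of_nonneg (Real.sqrt_nonneg _)
  have hsq : |P.det| ^ 2 = |G.det| := by
    rw [hdetP, hdetG, ← Finset.prod_pow]
    exact Finset.prod_congr rfl fun i _ => Real.sq_sqrt (abs_nonneg _)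
  have hP0 : P.det ≠ 0 := by
    intro h
    rw [h] at hsq
    exact hdet (abs_eq_zero.mp (by simpa using hsq.symm))
  -- `|det P|` is the square root of `|det G|`; adding 1 avoids the root and makes the base at least
  -- 1, so that raising it to a power only helps.
  have hlt : |P.det| < (|G.det| + 1) ^ Fintype.card ι := by
    calc |P.det| < |G.det| + 1 := by nlinarith [sq_nonneg (|P.det| - 1)]
      _ ≤ _ := le_self_pow₀ (by linarith [abs_nonneg G.det]) Fintype.card_ne_zero
  obtain ⟨z, hz0, hz⟩ := exists_int_vec_linear_forms_le P hP0 _ (by positivity) hlt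
  refine ⟨z, hz0, ?_⟩
  set x : ι → ℝ := fun j => (z j : ℝ)
  have hval : x ⬝ᵥ G *ᵥ x = ∑ i, l i * ((star U) *ᵥ x) i ^ 2 := by
    rw [hGU, ← mulVec_mulVec, ← mulVec_mulVec, dotProduct_mulVec, ← mulVec_transpose]
    have : Uᵀ = star U := by
      rw [star_eq_conjTranspose, conjTranspose_eq_transpose_of_trivial]
    rw [this]
    simp only [dotProduct, mulVec_diagonal]
    exact Finset.sum_congr rfl fun i _ => by ring
  have hPx : ∀ i, (P *ᵥ x) i = √|l i| * ((star U) *ᵥ x) i := by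
    intro i
    rw [← mulVec_mulVec, mulVec_diagonal]
  rw [hval]
  calc |∑ i, l i * ((star U) *ᵥ x) i ^ 2|
      ≤ ∑ i, |l i * ((star U) *ᵥ x) i ^ 2| := Finset.abs_sum_le_sum_abs _ _
    _ = ∑ i, |(P *ᵥ x) i| ^ 2 := by
        refine Finset.sum_congr rfl fun i _ => ?_
        rw [hPx, sq_abs, mul_pow, Real.sq_sqrt (abs_nonneg _), abs_mul,
          abs_of_nonneg (sq_nonneg ((star U *ᵥ x) i))]
    _ ≤ ∑ _i : ι, (|G.det| + 1) ^ 2 :=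
        Finset.sum_le_sum fun i _ => pow_le_pow_left₀ (abs_nonneg _) (hz i) 2
    _ = _ := by simp
-- Integral lattices, discriminants and short vectors.
/-- The Gram matrix of a tuple of vectors. -/
def gram {M : Type*} [AddCommGroup M] (b : LinearMap.BilinForm ℤ M) {ι : Type*} (s : ι → M) :
    Matrix ι ι ℤ :=
  Matrix.of fun i j => b (s i) (s j)

@[simp]
theorem gram_apply {M : Type*} [AddCommGroup M] (b : LinearMap.BilinForm ℤ M) {ι : Type*}
    (s : ι → M) (i j : ι) : gram b s i j = b (s i) (s j) :=
  rfl

/-- `E` times any functional is represented by a vector: the discriminant group is annihilated by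
`E`. -/
def DualBound {M : Type*} [AddCommGroup M] (b : LinearMap.BilinForm ℤ M) (E : ℤ) : Prop :=
  ∀ f : M →ₗ[ℤ] ℤ, ∃ u : M, ∀ x, b u x = E * f x

section Lattice

variable {M : Type*} [AddCommGroup M] (b : LinearMap.BilinForm ℤ M)

theorem bilin_sum_smul {ι : Type*} [Fintype ι] (z w : ι → ℤ) (s : ι → M) :
    b (∑ i, z i • s i) (∑ i, w i • s i) = z ⬝ᵥ (gram b s).mulVec w := by
  simp only [map_sum, LinearMap.sum_apply, dotProduct, Matrix.mulVec, Finset.mul_sum, map_smul,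
    LinearMap.smul_apply, gram_apply, smul_eq_mul]
  rw [Finset.sum_comm]
  exact Finset.sum_congr rfl fun i _ => Finset.sum_congr rfl fun j _ => by ring

/-- The vectors representing `E` times the dual basis, written in the basis `e`, form an integral
matrix `X` with `X * gram = E • 1`; take determinants. -/
theorem DualBound.det_gram_dvd {b : LinearMap.BilinForm ℤ M} {E : ℤ} (h : DualBound b E)
    {ι : Type*} [Fintype ι] [DecidableEq ι] (e : Module.Basis ι ℤ M) :
    (gram b e).det ∣ E ^ Fintype.card ι := by
  choose u hu using fun i => h (e.coord i)
  let X : Matrix ι ι ℤ := Matrix.of fun i j => e.repr (u i) j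
  have hX : X * gram b e = E • (1 : Matrix ι ι ℤ) := by
    ext i k
    have h1 : b (u i) (e k) = ∑ j, e.repr (u i) j * b (e j) (e k) := by
      conv_lhs => rw [← e.sum_repr (u i)]
      simp only [map_sum, LinearMap.sum_apply, map_smul, LinearMap.smul_apply, smul_eq_mul]
    rw [Matrix.mul_apply]
    simp only [X, Matrix.of_apply, gram_apply, ← h1, hu]
    simp [Matrix.one_apply, Finsupp.single_apply, eq_comm]
  have := congrArg Matrix.det hX
  rw [Matrix.det_mul, Matrix.det_smul, Matrix.det_one, mul_one] at this
  exact ⟨_, by rw [← this, mul_comm]⟩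

/-- A lattice with bounded discriminant contains a nonisotropic vector of bounded square. -/
theorem DualBound.exists_small [Module.Free ℤ M] [Module.Finite ℤ M] [Nontrivial M]
    {b : LinearMap.BilinForm ℤ M} (hb : ∀ x y, b x y = b y x) {E : ℤ} (hE : E ≠ 0)
    (h : DualBound b E) {m : ℕ} (hm : Module.finrank ℤ M ≤ m) :
    ∃ v : M, b v v ≠ 0 ∧ |b v v| ≤ m * (|E| ^ m + 1) ^ 2 + 2 * |E| := by
  classical
  let e := Module.Free.chooseBasis ℤ M
  have hcard : Fintype.card (Module.Free.ChooseBasisIndex ℤ M) = Module.finrank ℤ M :=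
    (Module.finrank_eq_card_chooseBasisIndex ℤ M).symm
  have hE1 : 1 ≤ |E| := Int.one_le_abs hE
  have hdvd := h.det_gram_dvd e
  have hpow : E ^ Fintype.card (Module.Free.ChooseBasisIndex ℤ M) ≠ 0 := pow_ne_zero _ hE
  have hdet0 : (gram b e).det ≠ 0 := fun h0 => hpow (by rwa [h0, zero_dvd_iff] at hdvd)
  have hdetle : |(gram b e).det| ≤ |E| ^ m := by
    calc |(gram b e).det| ≤ |E ^ Fintype.card (Module.Free.ChooseBasisIndex ℤ M)| :=
          Int.le_of_dvd (abs_pos.mpr hpow) ((abs_dvd_abs _ _).mpr hdvd)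
      _ = |E| ^ Module.finrank ℤ M := by rw [abs_pow, hcard]
      _ ≤ _ := pow_le_pow_right₀ hE1 hm
  have : Nonempty (Module.Free.ChooseBasisIndex ℤ M) := e.index_nonempty
  let G : Matrix _ _ ℝ := (gram b e).map (Int.castRingHom ℝ)
  have hGdet : G.det = ((gram b e).det : ℝ) := ((Int.castRingHom ℝ).map_det (gram b e)).symm
  have hGH : G.IsHermitian := by
    ext i j
    simp [G, hb (e i) (e j)]
  obtain ⟨z, hz0, hz⟩ := exists_int_vec_form_le G hGH (by rw [hGdet]; exact_mod_cast hdet0)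
  have hz' : |b (∑ i, z i • e i) (∑ i, z i • e i)| ≤ m * (|E| ^ m + 1) ^ 2 := by
    have h1 : ((b (∑ i, z i • e i) (∑ i, z i • e i) : ℤ) : ℝ)
        = (fun j => (z j : ℝ)) ⬝ᵥ G.mulVec (fun j => (z j : ℝ)) := by
      rw [bilin_sum_smul]
      simp [dotProduct, Matrix.mulVec, G]
    rw [← h1, hGdet, hcard] at hz
    have h2 : |b (∑ i, z i • e i) (∑ i, z i • e i)|
        ≤ Module.finrank ℤ M * (|(gram b e).det| + 1) ^ 2 := by exact_mod_cast hz
    refine h2.trans ?_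
    gcongr
  by_cases hv : b (∑ i, z i • e i) (∑ i, z i • e i) = 0
  swap
  · exact ⟨_, hv, hz'.trans (by linarith)⟩
  -- The short vector is isotropic. Its primitive part `v` has a functional with value 1, hence some
  -- `u` with `b u v = E`; adding multiples of `v` to `u` then changes the square by multiples of `2
  -- * E`.
  obtain ⟨w, hw, hw1⟩ := Finset.extract_gcd z (Finset.univ_nonempty)
  obtain ⟨c, hc⟩ := Finset.gcd_eq_sum_mul Finset.univ w
  have hg : Finset.univ.gcd z ≠ 0 := fun h0 => hz0 (funext fun i => by
    rw [hw i (Finset.mem_univ i), h0, zero_mul]; rfl)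
  set g := Finset.univ.gcd z
  set v := ∑ i, w i • e i with hvdef
  have hzv : ∑ i, z i • e i = g • v := by
    rw [hvdef, Finset.smul_sum]
    exact Finset.sum_congr rfl fun i hi => by rw [hw i hi, mul_smul]
  have hvv : b v v = 0 := by
    rw [hzv] at hv
    simpa [hg] using hv
  let f : M →ₗ[ℤ] ℤ := ∑ i, c i • e.coord i
  have hfv : f v = 1 := by
    have : ∀ i, e.repr v i = w i := fun i => by rw [hvdef, e.repr_sum_self]
    simp only [f, LinearMap.sum_apply, LinearMap.smul_apply, Module.Basis.coord_apply, this,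
      smul_eq_mul]
    rw [← hw1, hc]
    exact Finset.sum_congr rfl fun i _ => by ring
  obtain ⟨u, hu⟩ := h f
  have huv : b u v = E := by rw [hu, hfv, mul_one]
  -- Reducing `b u u - 1` rather than `b u u` puts the square in the range from 1 to `2 * |E|`, so
  -- it cannot vanish.
  have hval : b (u + (-((b u u - 1) / (2 * E))) • v) (u + (-((b u u - 1) / (2 * E))) • v)
      = (b u u - 1) % (2 * E) + 1 := by
    have := Int.mul_ediv_add_emod (b u u - 1) (2 * E)
    simp only [map_add, LinearMap.add_apply, map_smul, LinearMap.smul_apply, smul_eq_mul, hvv,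
      huv, hb v u]
    linear_combination -this
  have h2E : 2 * E ≠ 0 := by simpa using hE
  have hnn := Int.emod_nonneg (b u u - 1) h2E
  have hlt := Int.emod_lt_abs (b u u - 1) h2E
  rw [abs_mul, abs_two] at hlt
  refine ⟨_, by rw [hval]; omega, ?_⟩
  rw [hval, abs_of_nonneg (by omega)]
  have : (0 : ℤ) ≤ m * (|E| ^ m + 1) ^ 2 := by positivity
  omega

/-- Orthogonal projection, after multiplication by the Gram determinant. -/
theorem exists_smul_sub_orthogonal (hb : ∀ x y, b x y = b y x) {ι : Type*} [Fintype ι]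
    [DecidableEq ι] (s : ι → M) (x : M) :
    ∃ c : ι → ℤ, ∀ j, b ((gram b s).det • x - ∑ i, c i • s i) (s j) = 0 := by
  refine ⟨(gram b s).adjugate.mulVec fun i => b x (s i), fun j => ?_⟩
  have h := congrFun (congrArg (fun A => A.mulVec fun i => b x (s i))
    (Matrix.mul_adjugate (gram b s))) j
  simp only [← Matrix.mulVec_mulVec, Matrix.smul_mulVec, Matrix.one_mulVec, Pi.smul_apply,
    smul_eq_mul] at h
  simp only [map_sub, map_smul, LinearMap.sub_apply, LinearMap.smul_apply, map_sum,
    LinearMap.sum_apply, smul_eq_mul, ← h]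
  rw [Matrix.mulVec, dotProduct, sub_eq_zero]
  exact Finset.sum_congr rfl fun i _ => by rw [gram_apply, hb (s j) (s i), mul_comm]

/-- Pairing with the members of a tuple. -/
def pairing {ι : Type*} (s : ι → M) : M →ₗ[ℤ] (ι → ℤ) :=
  LinearMap.pi fun i => b.flip (s i)

@[simp]
theorem pairing_apply {ι : Type*} (s : ι → M) (x : M) (i : ι) : pairing b s x i = b x (s i) :=
  rfl

/-- The image of the pairing is free, so its kernel is a direct summand and `f` extends to `M`. A
vector representing `D` times the extension is then projected to the kernel, which costs the Gram
determinant. The resulting bound depends on the tuple only through that determinant. -/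
theorem DualBound.orthogonal [Module.Free ℤ M] [Module.Finite ℤ M]
    {b : LinearMap.BilinForm ℤ M} (hb : ∀ x y, b x y = b y x) {D : ℤ} (h : DualBound b D)
    {ι : Type*} [Fintype ι] [DecidableEq ι] (s : ι → M) :
    DualBound (b.restrict (LinearMap.ker (pairing b s))) (D * (gram b s).det) := by
  intro f
  obtain ⟨σ, hσ⟩ := Module.projective_lifting_property (pairing b s).rangeRestrict LinearMap.id
    (LinearMap.surjective_rangeRestrict _)
  have hσ' : ∀ y, pairing b s (σ y) = y := fun y =>
    congrArg Subtype.val (LinearMap.congr_fun hσ y)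
  let r : M →ₗ[ℤ] LinearMap.ker (pairing b s) :=
    LinearMap.codRestrict _ (LinearMap.id - σ ∘ₗ (pairing b s).rangeRestrict) fun x => by
      simp [hσ']
  have hr : ∀ x : LinearMap.ker (pairing b s), r x = x := by
    intro x
    have hx : (pairing b s).rangeRestrict x = 0 := Subtype.ext x.2
    apply Subtype.ext
    simp [r, hx]
  obtain ⟨u, hu⟩ := h (f ∘ₗ r)
  obtain ⟨c, hc⟩ := exists_smul_sub_orthogonal b hb s u
  refine ⟨⟨_, funext fun j => hc j⟩, fun x => ?_⟩
  have hsx : ∀ i, b (s i) x = 0 := fun i => by rw [hb]; exact congrFun x.2 i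
  have hux := hu x
  simp only [LinearMap.coe_comp, Function.comp_apply, hr] at hux
  simp only [LinearMap.BilinForm.restrict_apply, LinearMap.domRestrict_apply, map_sub, map_smul,
    LinearMap.sub_apply, LinearMap.smul_apply, map_sum, LinearMap.sum_apply, hsx, hux,
    smul_eq_mul, mul_zero, Finset.sum_const_zero, sub_zero]
  ring

end Lattice
-- Extending tuples to full rank and classifying them up to isometry.
section Tuples

variable {M : Type*} [AddCommGroup M] {b : LinearMap.BilinForm ℤ M}

/-- Orthogonal to a nondegenerate tuple of bounded Gram matrix that does not span rationally, there
is a nonisotropic vector of bounded square. -/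
theorem exists_orthogonal_small [Module.Free ℤ M] [Module.Finite ℤ M]
    (hb : ∀ x y, b x y = b y x) {D : ℤ} (hD : D ≠ 0)
    (h : DualBound b D) {k : ℕ} (hk : k < Module.finrank ℤ M) (N : ℤ) :
    ∃ N' : ℤ, ∀ s : Fin k → M, (gram b s).det ≠ 0 → (∀ i j, |b (s i) (s j)| ≤ N) →
      ∃ v : M, (∀ i, b v (s i) = 0) ∧ b v v ≠ 0 ∧ |b v v| ≤ N' := by
  -- The Leibniz expansion bounds the Gram determinant by `k! * N ^ k`.
  let F : ℤ := |D| * (k.factorial • N ^ k)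
  refine ⟨Module.finrank ℤ M * (F ^ Module.finrank ℤ M + 1) ^ 2 + 2 * F, fun s hs hN => ?_⟩
  have hdet : |(gram b s).det| ≤ k.factorial • N ^ k := by
    have := Matrix.det_le (A := gram b s) (abv := AbsoluteValue.abs) (x := N) hN
    simpa using this
  have hEF : |D * (gram b s).det| ≤ F := by
    rw [abs_mul]
    exact mul_le_mul_of_nonneg_left hdet (abs_nonneg D)
  have hnt : Nontrivial (LinearMap.ker (pairing b s)) := by
    rw [Submodule.nontrivial_iff_ne_bot]
    intro hbot
    have := LinearMap.finrank_le_finrank_of_injective (LinearMap.ker_eq_bot.mp hbot)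
    rw [Module.finrank_pi, Fintype.card_fin] at this
    omega
  obtain ⟨v, hv0, hv⟩ := DualBound.exists_small
    (b := b.restrict (LinearMap.ker (pairing b s))) (fun x y => hb x y)
    (mul_ne_zero hD hs) (h.orthogonal hb s)
    (Submodule.finrank_le (LinearMap.ker (pairing b s)))
  refine ⟨v, fun i => congrFun v.2 i, hv0, hv.trans ?_⟩
  gcongr

theorem det_gram_append (hb : ∀ x y, b x y = b y x) {k : ℕ} (s : Fin k → M) (v : M)
    (hv : ∀ i, b v (s i) = 0) :
    (gram b (Fin.append s fun _ : Fin 1 => v)).det = (gram b s).det * b v v := by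
  rw [← Matrix.det_submatrix_equiv_self finSumFinEquiv]
  have : (gram b (Fin.append s fun _ : Fin 1 => v)).submatrix finSumFinEquiv finSumFinEquiv
      = Matrix.fromBlocks (gram b s) 0 0 (Matrix.of fun _ _ : Fin 1 => b v v) := by
    ext i j
    rcases i with i | i <;> rcases j with j | j <;>
      simp [hv, hb (s _) v, Fin.append_left, Fin.append_right]
  rw [this, Matrix.det_fromBlocks_zero₂₁]
  simp

/-- A nondegenerate tuple of bounded Gram matrix extends to such a tuple of full rank. -/
theorem exists_extension [Module.Free ℤ M] [Module.Finite ℤ M]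
    (hb : ∀ x y, b x y = b y x) {D : ℤ} (hD : D ≠ 0) (h : DualBound b D)
    {k m : ℕ} (hm : Module.finrank ℤ M = m) (hk : k ≤ m) (N : ℤ) :
    ∃ N' : ℤ, ∀ s : Fin k → M, (gram b s).det ≠ 0 → (∀ i j, |b (s i) (s j)| ≤ N) →
      ∃ t : Fin m → M, (gram b t).det ≠ 0 ∧ (∀ i j, |b (t i) (t j)| ≤ N') ∧
        ∀ i, t (Fin.castLE hk i) = s i := by
  induction hj : m - k generalizing k N with
  | zero =>
    obtain rfl : k = m := by omega
    exact ⟨N, fun s hs hN => ⟨s, hs, hN, fun i => rfl⟩⟩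
  | succ j ih =>
    obtain ⟨N₁, hN₁⟩ := exists_orthogonal_small hb hD h (k := k) (by omega) N
    -- The 0 covers the vanishing pairings of the new vector with the old ones.
    obtain ⟨N', hN'⟩ := ih (k := k + 1) (by omega) (max N (max N₁ 0)) (by omega)
    refine ⟨N', fun s hs hN => ?_⟩
    obtain ⟨v, hv, hv0, hvN⟩ := hN₁ s hs hN
    obtain ⟨t, ht0, htN, ht⟩ := hN' (Fin.append s fun _ : Fin 1 => v)
      (by rw [det_gram_append hb s v hv]; exact mul_ne_zero hs hv0) (by
        intro i j
        refine Fin.addCases (fun i => ?_) (fun i => ?_) i <;>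
          refine Fin.addCases (fun j => ?_) (fun j => ?_) j <;>
          simp only [Fin.append_left, Fin.append_right, hv, hb (s _) v, abs_zero]
        · exact (hN i j).trans (le_max_left _ _)
        · exact (le_max_right _ _).trans (le_max_right _ _)
        · exact (le_max_right _ _).trans (le_max_right _ _)
        · exact hvN.trans ((le_max_left _ _).trans (le_max_right _ _)))
    refine ⟨t, ht0, htN, fun i => ?_⟩
    rw [← Fin.append_left s (fun _ : Fin 1 => v) i, ← ht]
    rfl

/-- In a basis of `M`, the transposed Gram matrix is the matrix of the pairing times the coordinate
matrix of `t`, so the former is nonsingular. -/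
theorem pairing_injective [Module.Free ℤ M] [Module.Finite ℤ M]
    {m : ℕ} (hm : Module.finrank ℤ M = m) (t : Fin m → M)
    (ht : (gram b t).det ≠ 0) : Function.Injective (pairing b t) := by
  let e : M ≃ₗ[ℤ] (Fin m → ℤ) := (Module.finBasisOfFinrankEq ℤ M hm).equivFun
  let A : Matrix (Fin m) (Fin m) ℤ := LinearMap.toMatrix' (pairing b t ∘ₗ e.symm.toLinearMap)
  let C : Matrix (Fin m) (Fin m) ℤ := Matrix.of fun i j => e (t j) i
  have hAC : A * C = (gram b t).transpose := by
    ext i j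
    have h1 : (A.mulVec (e (t j))) i = b (t j) (t i) := by
      simp [A, LinearMap.toMatrix'_mulVec]
    exact h1
  have hdet : A.det ≠ 0 := by
    intro h0
    have := congrArg Matrix.det hAC
    rw [Matrix.det_mul, h0, zero_mul, Matrix.det_transpose] at this
    exact ht this.symm
  have hinj := Matrix.mulVec_injective_of_det_ne_zero hdet
  intro x y hxy
  apply e.injective
  apply hinj
  simpa [A, LinearMap.toMatrix'_mulVec] using hxy

/-- Two full-rank tuples with equal Gram matrices and equal pairing images are isometric. -/
theorem exists_isometry [Module.Free ℤ M] [Module.Finite ℤ M]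
    (hb : ∀ x y, b x y = b y x) {m : ℕ} (hm : Module.finrank ℤ M = m)
    (t t' : Fin m → M) (ht : (gram b t).det ≠ 0) (hgram : gram b t = gram b t')
    (hrange : LinearMap.range (pairing b t) = LinearMap.range (pairing b t')) :
    ∃ g : M ≃ₗ[ℤ] M, (∀ x y, b (g x) (g y) = b x y) ∧ ∀ i, g (t i) = t' i := by
  have hinj := pairing_injective hm t ht
  have hinj' := pairing_injective hm t' (hgram ▸ ht)
  -- Both pairings embed `M` in `ℤ^m` with the same image; `g` identifies the two embeddings. It
  -- preserves `b` because a nonzero multiple of any `y` lies in the span of `t`.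
  let g : M ≃ₗ[ℤ] M := (LinearEquiv.ofInjective _ hinj).trans
    ((LinearEquiv.ofEq _ _ hrange).trans (LinearEquiv.ofInjective _ hinj').symm)
  have hg : ∀ x, pairing b t' (g x) = pairing b t x := by
    intro x
    have h1 : LinearEquiv.ofInjective _ hinj' (g x)
        = LinearEquiv.ofEq _ _ hrange (LinearEquiv.ofInjective _ hinj x) := by
      simp [g]
    exact congrArg Subtype.val h1
  have hg' : ∀ x i, b (g x) (t' i) = b x (t i) := fun x i => congrFun (hg x) i
  have hgt : ∀ i, g (t i) = t' i := by
    intro i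
    apply hinj'
    rw [hg]
    ext j
    exact congrFun (congrFun hgram i) j
  refine ⟨g, fun x y => ?_, hgt⟩
  obtain ⟨c, hc⟩ := exists_smul_sub_orthogonal b hb t y
  have hy : (gram b t).det • y = ∑ i, c i • t i := by
    rw [← sub_eq_zero]
    apply hinj
    ext j
    rw [pairing_apply, hc]
    simp
  apply mul_left_cancel₀ ht
  rw [← smul_eq_mul, ← smul_eq_mul, ← map_smul, ← map_smul,
    ← map_smul (b x), hy]
  simp [map_sum, hgt, hg']

/-- Such a submodule is the full preimage of its image in the finite group `(ℤ/N)^m`. -/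
theorem finite_submodules_containing_smul {m : ℕ} (N : ℤ) (hN : N ≠ 0) :
    {Λ : Submodule ℤ (Fin m → ℤ) | ∀ x, N • x ∈ Λ}.Finite := by
  have : NeZero N.natAbs := ⟨by simpa using hN⟩
  let f : (Fin m → ℤ) → (Fin m → ZMod N.natAbs) := fun x i => x i
  refine Set.Finite.of_finite_image (f := fun Λ : Submodule ℤ (Fin m → ℤ) => f '' Λ)
    (Set.toFinite _) ?_
  have key : ∀ Λ Λ' : Submodule ℤ (Fin m → ℤ), (∀ x, N • x ∈ Λ') →
      f '' Λ = f '' Λ' → Λ ≤ Λ' := by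
    intro Λ Λ' hΛ' heq x hx
    obtain ⟨y, hy, hxy⟩ : f x ∈ f '' Λ' := heq ▸ ⟨x, hx, rfl⟩
    have hdvd : ∀ i, ∃ w, x i - y i = N * w := by
      intro i
      have h1 : ((y i : ℤ) : ZMod N.natAbs) = x i := congrFun hxy i
      rw [ZMod.intCast_eq_intCast_iff_dvd_sub, Int.natCast_natAbs, abs_dvd] at h1
      exact h1
    choose w hw using hdvd
    have hx' : x = y + N • w := by
      ext i
      simp [← hw]
    rw [hx']
    exact Λ'.add_mem hy (hΛ' w)
  intro Λ hΛ Λ' hΛ' heq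
  exact le_antisymm (key _ _ hΛ' heq) (key _ _ hΛ heq.symm)

/-- The adjugate inverts the Gram matrix up to its determinant. Together with
`finite_submodules_containing_smul`, this leaves finitely many pairing images for each nonsingular
Gram matrix. -/
theorem det_smul_mem_range_pairing {m : ℕ} (hb : ∀ x y, b x y = b y x) (t : Fin m → M)
    (x : Fin m → ℤ) : (gram b t).det • x ∈ LinearMap.range (pairing b t) := by
  refine ⟨∑ i, (gram b t).adjugate.mulVec x i • t i, ?_⟩
  have h := congrArg (fun A => A.mulVec x) (Matrix.mul_adjugate (gram b t))
  simp only [← Matrix.mulVec_mulVec, Matrix.smul_mulVec, Matrix.one_mulVec] at h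
  rw [← h]
  ext j
  simp only [pairing_apply, map_sum, map_smul, LinearMap.sum_apply, LinearMap.smul_apply,
    smul_eq_mul]
  rw [Matrix.mulVec, dotProduct]
  exact Finset.sum_congr rfl fun i _ => by rw [gram_apply, hb (t j) (t i), mul_comm]

end Tuples

/-- A map with finite image on a set has finitely many representatives. -/
theorem exists_finite_representatives {α β : Type*} (X : Set α) (f : α → β)
    (hf : (f '' X).Finite) : ∃ T ⊆ X, T.Finite ∧ ∀ x ∈ X, ∃ t ∈ T, f x = f t := by
  obtain ⟨T, hTX, hT⟩ := Set.exists_subset_bijOn X f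
  refine ⟨T, hTX, Set.Finite.of_finite_image (hT.image_eq ▸ hf) hT.injOn, fun x hx => ?_⟩
  obtain ⟨t, ht, hft⟩ : f x ∈ f '' T := hT.image_eq ▸ ⟨x, hx, rfl⟩
  exact ⟨t, ht, hft.symm⟩

/-! ### Finitely many orbits of bounded tuples. -/

variable {L : Type*} [AddCommGroup L]

theorem mem_orthogonalGroup_of_polar (q : QuadraticForm ℤ L) (g : L ≃ₗ[ℤ] L)
    (hg : ∀ x y, q.polarBilin (g x) (g y) = q.polarBilin x y) : g ∈ orthogonalGroup q := by
  intro v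
  have := hg v v
  simpa using this

/-- Finitely many orbits of `O(L)` on nondegenerate tuples of bounded Gram matrix. -/
theorem exists_finite_tuples_orthogonalGroup [Module.Free ℤ L] [Module.Finite ℤ L]
    (q : QuadraticForm ℤ L) {D : ℤ} (hD : D ≠ 0) (h : DualBound q.polarBilin D)
    {k : ℕ} (hk : k ≤ Module.finrank ℤ L) (N : ℤ) :
    ∃ R : Set (Fin k → L), R.Finite ∧ ∀ s : Fin k → L, (gram q.polarBilin s).det ≠ 0 →
      (∀ i j, |q.polarBilin (s i) (s j)| ≤ N) →
      ∃ r ∈ R, ∃ g ∈ orthogonalGroup q, ∀ i, s i = g (r i) := by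
  have hb : ∀ x y, q.polarBilin x y = q.polarBilin y x := fun x y => QuadraticMap.polar_comm _ _ _
  set b := q.polarBilin with hbdef
  obtain ⟨N', hN'⟩ := exists_extension hb hD h rfl hk N
  choose! t ht0 htN hts using hN'
  let X : Set (Fin k → L) := {s | (gram b s).det ≠ 0 ∧ ∀ i j, |b (s i) (s j)| ≤ N}
  -- By `exists_isometry`, this pair is a complete isometry invariant of the extended tuple.
  let f : (Fin k → L) → Matrix (Fin (Module.finrank ℤ L)) (Fin (Module.finrank ℤ L)) ℤ ×
      Submodule ℤ (Fin (Module.finrank ℤ L) → ℤ) :=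
    fun s => (gram b (t s), LinearMap.range (pairing b (t s)))
  have hfin : (f '' X).Finite := by
    have h1 : {A : Matrix (Fin (Module.finrank ℤ L)) (Fin (Module.finrank ℤ L)) ℤ |
        ∀ i j, A i j ∈ Set.Icc (-N') N'}.Finite :=
      Set.Finite.pi' fun i => Set.Finite.pi' fun j => Set.finite_Icc _ _
    have h2 : (⋃ A ∈ {A : Matrix (Fin (Module.finrank ℤ L)) (Fin (Module.finrank ℤ L)) ℤ |
        (∀ i j, A i j ∈ Set.Icc (-N') N') ∧ A.det ≠ 0},
        ({A} : Set _) ×ˢ {Λ : Submodule ℤ (Fin (Module.finrank ℤ L) → ℤ) |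
          ∀ x, A.det • x ∈ Λ}).Finite :=
      Set.Finite.biUnion (h1.subset fun A hA => hA.1) fun A hA =>
        (Set.finite_singleton A).prod (finite_submodules_containing_smul _ hA.2)
    refine h2.subset ?_
    rintro _ ⟨s, ⟨hs0, hsN⟩, rfl⟩
    simp only [Set.mem_iUnion]
    exact ⟨gram b (t s), ⟨fun i j => abs_le.mp (htN s hs0 hsN i j), ht0 s hs0 hsN⟩, rfl,
      det_smul_mem_range_pairing hb (t s)⟩
  obtain ⟨R, hRX, hR, hrep⟩ := exists_finite_representatives X f hfin
  refine ⟨R, hR, fun s hs0 hsN => ?_⟩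
  obtain ⟨r, hr, hfr⟩ := hrep s ⟨hs0, hsN⟩
  obtain ⟨hr0, hrN⟩ := hRX hr
  obtain ⟨g, hg, hgt⟩ := exists_isometry hb rfl (t r) (t s) (ht0 r hr0 hrN)
    (congrArg Prod.fst hfr).symm (congrArg Prod.snd hfr).symm
  refine ⟨r, hr, g, mem_orthogonalGroup_of_polar q g hg, fun i => ?_⟩
  rw [← hts s hs0 hsN, ← hts r hr0 hrN, hgt]

/-- Finitely many orbits of a finite-index subgroup on nondegenerate tuples of bounded Gram
matrix. -/
theorem exists_finite_tuples [Module.Free ℤ L] [Module.Finite ℤ L]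
    (q : QuadraticForm ℤ L) {D : ℤ} (hD : D ≠ 0) (h : DualBound q.polarBilin D)
    (Γ : Subgroup (orthogonalGroup q)) (hΓ : Γ.FiniteIndex)
    {k : ℕ} (hk : k ≤ Module.finrank ℤ L) (N : ℤ) :
    ∃ R : Set (Fin k → L), R.Finite ∧ ∀ s : Fin k → L, (gram q.polarBilin s).det ≠ 0 →
      (∀ i j, |q.polarBilin (s i) (s j)| ≤ N) →
      ∃ r ∈ R, ∃ γ ∈ Γ, ∀ i, s i = (γ : L ≃ₗ[ℤ] L) (r i) := by
  obtain ⟨R, hR, hrep⟩ := exists_finite_tuples_orthogonalGroup q hD h hk N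
  have : Finite (orthogonalGroup q ⧸ Γ) := Subgroup.finite_quotient_of_finiteIndex
  let F : (orthogonalGroup q ⧸ Γ) × (Fin k → L) → (Fin k → L) :=
    fun p i => ((p.1.out⁻¹ : orthogonalGroup q) : L ≃ₗ[ℤ] L) (p.2 i)
  refine ⟨F '' (Set.univ ×ˢ R), (Set.finite_univ.prod hR).image F, fun s hs0 hsN => ?_⟩
  obtain ⟨r, hr, g, hg, hsr⟩ := hrep s hs0 hsN
  let g' : orthogonalGroup q := ⟨g, hg⟩
  -- `h'` represents the coset of `g⁻¹`, so `g * h'` lies in `Γ` and `s = (g * h') (h'⁻¹ r)`.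
  let h' : orthogonalGroup q := ((g'⁻¹ : orthogonalGroup q) : orthogonalGroup q ⧸ Γ).out
  have hmem : g' * h' ∈ Γ := by
    have : ((h' : orthogonalGroup q) : orthogonalGroup q ⧸ Γ) = (g'⁻¹ : orthogonalGroup q) :=
      QuotientGroup.out_eq' _
    have := QuotientGroup.eq.mp this.symm
    simpa using this
  refine ⟨_, ⟨(((g'⁻¹ : orthogonalGroup q) : orthogonalGroup q ⧸ Γ), r), ⟨trivial, hr⟩, rfl⟩,
    g' * h', hmem, fun i => ?_⟩
  have : ((g' * h' : orthogonalGroup q) : L ≃ₗ[ℤ] L)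
      (((h'⁻¹ : orthogonalGroup q) : L ≃ₗ[ℤ] L) (r i))
      = ((g' * h' * h'⁻¹ : orthogonalGroup q) : L ≃ₗ[ℤ] L) (r i) := rfl
  rw [hsr]
  refine Eq.trans ?_ this.symm
  rw [mul_inv_cancel_right]

/-! ### Lorentzian linear algebra. -/

/-- A symmetric bilinear form that is negative definite on the orthogonal complement of every
vector of positive square. -/
structure IsLorentzian {V : Type*} [AddCommGroup V] [Module ℝ V] (B : LinearMap.BilinForm ℝ V) :
    Prop where
  symm : ∀ x y, B x y = B y x
  neg : ∀ x y, 0 < B x x → B x y = 0 → y ≠ 0 → B y y < 0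

namespace IsLorentzian

variable {V : Type*} [AddCommGroup V] [Module ℝ V] {B : LinearMap.BilinForm ℝ V}

theorem nonpos (h : IsLorentzian B) {x y : V} (hx : 0 < B x x) (hxy : B x y = 0) :
    B y y ≤ 0 := by
  by_cases hy : y = 0
  · simp [hy]
  · exact (h.neg x y hx hxy hy).le

theorem ne_zero (h : IsLorentzian B) {x y : V} (hx : 0 < B x x) (hy : 0 < B y y) :
    B x y ≠ 0 :=
  fun hxy => (h.nonpos hx hxy).not_gt hy

/-- Cauchy–Schwarz on the complement of a positive vector. -/
theorem sq_le_of_perp (h : IsLorentzian B) {x u v : V} (hx : 0 < B x x) (hu : B x u = 0)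
    (hv : B x v = 0) : B u v ^ 2 ≤ B u u * B v v := by
  by_cases hv0 : v = 0
  · simp [hv0]
  have hvv := h.neg x v hx hv hv0
  have hw := h.nonpos (y := B v v • u - B u v • v) hx (by simp [hu, hv])
  have : B (B v v • u - B u v • v) (B v v • u - B u v • v)
      = B v v * (B u u * B v v - B u v ^ 2) := by
    simp only [map_sub, map_smul, LinearMap.sub_apply, LinearMap.smul_apply, smul_eq_mul,
      h.symm v u]
    ring
  rw [this] at hw
  nlinarith

/-- Nonnegativity of the Gram determinant of three vectors, one of them positive. -/
theorem gram_nonneg (h : IsLorentzian B) {x : V} (y s : V) (hx : 0 < B x x) :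
    B y y * B s x ^ 2 - 2 * B x y * B s x * B s y + B x x * B s y ^ 2
      ≤ -B s s * (B x y ^ 2 - B x x * B y y) := by
  have hcs := h.sq_le_of_perp (u := B x x • y - B x y • x) (v := B x x • s - B s x • x) hx
    (by simp [mul_comm]) (by simp [h.symm x s, mul_comm])
  simp only [map_sub, map_smul, LinearMap.sub_apply, LinearMap.smul_apply, smul_eq_mul,
    h.symm y x, h.symm x s, h.symm y s] at hcs
  have key : 0 ≤ B x x ^ 3 * (-B s s * (B x y ^ 2 - B x x * B y y) -
      (B y y * B s x ^ 2 - 2 * B x y * B s x * B s y + B x x * B s y ^ 2)) := by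
    linarith [hcs]
  have := nonneg_of_mul_nonneg_right key (by positivity)
  linarith

/-- If `B x z ≤ 0`, the combination of `x` and `z` orthogonal to `y` has only nonnegative terms in
its square, and positive ones among them, contradicting negativity on `y^⊥`. Hence lying in the same
half of the light cone is transitive. -/
theorem pos_trans (h : IsLorentzian B) {x y z : V} (hx : 0 < B x x) (hy : 0 < B y y)
    (hz : 0 < B z z) (hxy : 0 < B x y) (hyz : 0 < B y z) : 0 < B x z := by
  by_contra hxz
  push Not at hxz
  have h1 := h.nonpos (y := B y z • x - B x y • z) hy (by simp [h.symm y x, mul_comm])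
  simp only [map_sub, map_smul, LinearMap.sub_apply, LinearMap.smul_apply, smul_eq_mul,
    h.symm z x] at h1
  nlinarith [mul_pos (mul_pos hyz hyz) hx, mul_pos (mul_pos hxy hxy) hz,
    mul_nonneg (mul_pos hxy hyz).le (neg_nonneg.mpr hxz)]

theorem combo_pos (h : IsLorentzian B) {x y : V} (hx : 0 < B x x) (hy : 0 < B y y)
    (hxy : 0 < B x y) {a c : ℝ} (ha : 0 ≤ a) (hc : 0 ≤ c) (hac : a + c = 1) :
    0 < B (a • x + c • y) (a • x + c • y) := by
  simp only [map_add, map_smul, LinearMap.add_apply, LinearMap.smul_apply, smul_eq_mul,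
    h.symm y x]
  rcases ha.eq_or_lt with rfl | ha
  · obtain rfl : c = 1 := by linarith
    linarith
  · nlinarith [mul_pos (mul_pos ha ha) hx, mul_nonneg (mul_nonneg hc hc) hy.le,
      mul_nonneg (mul_nonneg ha.le hc) hxy.le]

theorem separating (h : IsLorentzian B) {x : V} (hx : 0 < B x x) {u : V}
    (hu : ∀ v, B v u = 0) : u = 0 := by
  by_contra hu0
  have := h.neg x u hx (hu x) hu0
  rw [hu] at this
  exact lt_irrefl _ this

/-- Linear functionals are bounded on vectors with bounded pairing with a positive vector and
square bounded below. -/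
theorem exists_abs_le [FiniteDimensional ℝ V] (h : IsLorentzian B) {x : V} (hx : 0 < B x x)
    (f : V →ₗ[ℝ] ℝ) (R N : ℝ) :
    ∃ C, ∀ s, |B s x| ≤ R → -N ≤ B s s → |f s| ≤ C := by
  have hinj : Function.Injective B := by
    rw [← LinearMap.ker_eq_bot, LinearMap.ker_eq_bot']
    intro u hu
    exact h.separating hx fun v => by rw [h.symm, hu, LinearMap.zero_apply]
  obtain ⟨u, hu⟩ := (LinearMap.injective_iff_surjective_of_finrank_eq_finrank
    (Subspace.dual_finrank_eq (K := ℝ) (V := V)).symm).mp hinj f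
  let A := B x x
  let g := B x u
  let K := A * B u u - g ^ 2
  refine ⟨(|K| * (R ^ 2 + A * N) + 1 + R * |g|) / A, fun s hs hN => ?_⟩
  -- Nondegeneracy writes `f` as pairing with `u`; Cauchy–Schwarz is applied to the components of
  -- `u` and `s` orthogonal to `x`, scaled by `A`.
  have hcs := h.sq_le_of_perp (u := A • u - g • x) (v := A • s - B s x • x) hx
    (by simp [A, g, mul_comm]) (by simp [A, h.symm x s, mul_comm])
  have hfs : B u s = f s := by rw [hu]
  simp only [map_sub, map_smul, LinearMap.sub_apply, LinearMap.smul_apply, smul_eq_mul,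
    h.symm u x, h.symm x s, hfs] at hcs
  have hA : 0 < A := hx
  have h1 : (A * f s - B s x * g) ^ 2 ≤ K * (A * B s s - B s x ^ 2) := by
    have : 0 ≤ A ^ 2 * (K * (A * B s s - B s x ^ 2) - (A * f s - B s x * g) ^ 2) := by
      simp only [K]
      have e1 : B x x = A := rfl
      have e2 : B x u = g := rfl
      rw [e1, e2] at hcs
      linarith [hcs]
    have := nonneg_of_mul_nonneg_right this (by positivity)
    linarith
  have hR : B s x ^ 2 ≤ R ^ 2 := sq_le_sq' (by linarith [abs_le.mp hs]) (abs_le.mp hs).2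
  have h2 : (A * f s - B s x * g) ^ 2 ≤ |K| * (R ^ 2 + A * N) := by
    have hneg : 0 ≤ B s x ^ 2 - A * B s s := by
      have := h.nonpos (y := A • s - B s x • x) hx (by simp [A, h.symm x s, mul_comm])
      simp only [map_sub, map_smul, LinearMap.sub_apply, LinearMap.smul_apply, smul_eq_mul,
        h.symm x s] at this
      have e1 : B x x = A := rfl
      rw [e1] at this
      have : 0 ≤ A * (B s x ^ 2 - A * B s s) := by linarith
      exact nonneg_of_mul_nonneg_right this hA
    calc _ ≤ K * (A * B s s - B s x ^ 2) := h1
      _ = (-K) * (B s x ^ 2 - A * B s s) := by ring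
      _ ≤ |K| * (B s x ^ 2 - A * B s s) :=
          mul_le_mul_of_nonneg_right (neg_le_abs K) hneg
      _ ≤ _ := mul_le_mul_of_nonneg_left (by nlinarith) (abs_nonneg K)
  have h3 : |A * f s - B s x * g| ≤ |K| * (R ^ 2 + A * N) + 1 := by
    nlinarith [sq_abs (A * f s - B s x * g), sq_nonneg (|A * f s - B s x * g| - 1),
      abs_nonneg (A * f s - B s x * g)]
  have h4 : |B s x * g| ≤ R * |g| := by
    rw [abs_mul]
    exact mul_le_mul_of_nonneg_right hs (abs_nonneg g)
  rw [le_div_iff₀ hA, mul_comm]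
  calc A * |f s| = |A * f s| := by rw [abs_mul, abs_of_pos hA]
    _ = |(A * f s - B s x * g) + B s x * g| := by ring_nf
    _ ≤ _ := (abs_add_le _ _).trans (add_le_add h3 h4)

end IsLorentzian

/-! ### The real form of a lattice and local finiteness of the hyperplanes. -/

theorem realBilin_tmul (q : QuadraticForm ℤ L) (a c : ℝ) (s t : L) :
    realBilin q (a ⊗ₜ[ℤ] s) (c ⊗ₜ[ℤ] t) = a * c * (q.polarBilin s t : ℝ) := by
  simp [realBilin, LinearMap.BilinForm.baseChange_tmul]
  ring

theorem realBilin_symm (q : QuadraticForm ℤ L) (x y : RealSpace L) :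
    realBilin q x y = realBilin q y x := by
  rw [← polar_realForm, ← polar_realForm, QuadraticMap.polar_comm]

theorem realBilin_self (q : QuadraticForm ℤ L) (x : RealSpace L) :
    realBilin q x x = 2 * realForm q x := by
  simp [realForm]

/-- A counterexample `y` would span with `x` a plane on which the form is nonnegative, leaving room
for at most `n - 1` negative directions in dimension `n + 1`. -/
theorem HasSignature.isLorentzian [Module.Free ℤ L] [Module.Finite ℤ L]
    {q : QuadraticForm ℤ L} {n : ℕ} (hq : HasSignature q 1 n) : IsLorentzian (realBilin q) := by
  refine ⟨realBilin_symm q, fun x y hx hxy hy => ?_⟩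
  by_contra hyy
  push Not at hyy
  have hli : LinearIndependent ℝ ![x, y] := by
    rw [LinearIndependent.pair_iff]
    intro a c hac
    have h1 : a * realBilin q x x = 0 := by
      have := congrArg (realBilin q x) hac
      simpa [hxy] using this
    have ha : a = 0 := by simpa [hx.ne'] using h1
    refine ⟨ha, ?_⟩
    rw [ha, zero_smul, zero_add, smul_eq_zero] at hac
    exact hac.resolve_right hy
  have hrank : Module.finrank ℝ (Submodule.span ℝ (Set.range ![x, y])) = 2 := by
    simpa using finrank_span_eq_card hli
  have hle := QuadraticForm.sigPos_add_finrank_le_of_nonpos (Q := -realForm q)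
    (V := Submodule.span ℝ (Set.range ![x, y])) (by
      intro z hz
      rw [Matrix.range_cons, Matrix.range_cons, Matrix.range_empty, Set.union_empty,
        Set.singleton_union, Submodule.mem_span_pair] at hz
      obtain ⟨a, c, rfl⟩ := hz
      have h1 := realBilin_self q (a • x + c • y)
      simp only [map_add, map_smul, LinearMap.add_apply, LinearMap.smul_apply, smul_eq_mul,
        realBilin_symm q y x, hxy] at h1
      have h2 : 0 ≤ a * (a * realBilin q x x) + c * (c * realBilin q y y) := by
        rw [← mul_assoc, ← mul_assoc]
        exact add_nonneg (mul_nonneg (mul_self_nonneg a) hx.le)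
          (mul_nonneg (mul_self_nonneg c) hyy)
      rw [neg_apply]
      linarith)
  rw [sigPos_neg, hrank, hq.2.2, Module.finrank_baseChange, hq.1] at hle
  omega

theorem one_tmul_eq_zero [Module.Free ℤ L] {s : L}
    (hs : (1 : ℝ) ⊗ₜ[ℤ] s = (0 : RealSpace L)) : s = 0 := by
  let e := Module.Free.chooseBasis ℤ L
  apply e.repr.injective
  ext i
  have h1 : (e.baseChange ℝ).repr ((1 : ℝ) ⊗ₜ[ℤ] s) i = 0 := by rw [hs]; simp
  simpa using h1

/-- Each coordinate of `s` in a lattice basis is an integer bounded by `IsLorentzian.exists_abs_le`.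
-/
theorem finite_lattice_bounded [Module.Free ℤ L] [Module.Finite ℤ L] {q : QuadraticForm ℤ L}
    (h : IsLorentzian (realBilin q)) {x : RealSpace L} (hx : 0 < realBilin q x x) (R : ℝ) (N : ℤ) :
    {s : L | |realBilin q ((1 : ℝ) ⊗ₜ[ℤ] s) x| ≤ R ∧ -N ≤ q.polarBilin s s}.Finite := by
  let e := Module.Free.chooseBasis ℤ L
  choose C hC using fun i => h.exists_abs_le hx ((e.baseChange ℝ).coord i) R N
  refine Set.Finite.of_finite_image (f := e.equivFun) ?_ e.equivFun.injective.injOn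
  refine (Set.Finite.pi' fun i => Set.finite_Icc (-⌈C i⌉) ⌈C i⌉).subset ?_
  rintro _ ⟨s, ⟨hs, hsN⟩, rfl⟩ i
  have h1 := hC i ((1 : ℝ) ⊗ₜ[ℤ] s) hs (by
    rw [realBilin_tmul, one_mul, one_mul]
    exact_mod_cast hsN)
  have h2 : ((e.equivFun s i : ℤ) : ℝ) = (e.baseChange ℝ).coord i ((1 : ℝ) ⊗ₜ[ℤ] s) := by
    simp
  rw [← h2, abs_le] at h1
  refine ⟨?_, ?_⟩
  · have : (((-⌈C i⌉ : ℤ)) : ℝ) ≤ (e.equivFun s i : ℤ) := by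
      push_cast
      linarith [Int.le_ceil (C i)]
    exact_mod_cast this
  · exact_mod_cast h1.2.trans (Int.le_ceil (C i))

/-- Local finiteness: only finitely many hyperplanes meet a given segment. -/
theorem finite_separating [Module.Free ℤ L] [Module.Finite ℤ L] {q : QuadraticForm ℤ L}
    (h : IsLorentzian (realBilin q)) {x y : RealSpace L} (hx : 0 < realBilin q x x)
    (hy : 0 < realBilin q y y) (hxy : 0 < realBilin q x y) (N : ℤ) :
    {s : L | -N ≤ q.polarBilin s s ∧
      realBilin q ((1 : ℝ) ⊗ₜ[ℤ] s) x * realBilin q ((1 : ℝ) ⊗ₜ[ℤ] s) y ≤ 0}.Finite := by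
  set B := realBilin q
  let K := B x y ^ 2 - B x x * B y y
  have hK : 0 ≤ K := by
    have h1 := h.nonpos (y := B x x • y - B x y • x) hx (by simp [B, mul_comm])
    simp only [map_sub, map_smul, LinearMap.sub_apply, LinearMap.smul_apply, smul_eq_mul,
      h.symm y x] at h1
    have h2 : 0 ≤ B x x * K := by simp only [K]; linarith
    exact nonneg_of_mul_nonneg_right h2 hx
  refine (finite_lattice_bounded h hx (N * K / B y y + 1) N).subset ?_
  rintro s ⟨hsN, hs⟩
  refine ⟨?_, hsN⟩
  have hg := h.gram_nonneg y ((1 : ℝ) ⊗ₜ[ℤ] s) hx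
  set a := B ((1 : ℝ) ⊗ₜ[ℤ] s) x
  set c := B ((1 : ℝ) ⊗ₜ[ℤ] s) y
  have hss : -(N : ℝ) ≤ B ((1 : ℝ) ⊗ₜ[ℤ] s) ((1 : ℝ) ⊗ₜ[ℤ] s) := by
    simp only [B]
    rw [realBilin_tmul, one_mul, one_mul]
    exact_mod_cast hsN
  have h1 : -B ((1 : ℝ) ⊗ₜ[ℤ] s) ((1 : ℝ) ⊗ₜ[ℤ] s) * K ≤ N * K :=
    mul_le_mul_of_nonneg_right (by linarith) hK
  -- Since `s` does not have `x` and `y` strictly on one side, the cross term of the Gram inequality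
  -- has the favourable sign and can be dropped.
  have h2 : B y y * a ^ 2 ≤ N * K := by
    have h3 : 0 ≤ -(B x y * (a * c)) := by
      have := mul_nonneg hxy.le (neg_nonneg.mpr hs)
      linarith
    have h4 : 0 ≤ B x x * c ^ 2 := by positivity
    have h5 : B y y * a ^ 2 - 2 * B x y * a * c + B x x * c ^ 2
      ≤ -B ((1 : ℝ) ⊗ₜ[ℤ] s) ((1 : ℝ) ⊗ₜ[ℤ] s) * K := hg
    linarith
  have h6 : a ^ 2 ≤ N * K / B y y := by
    rw [le_div_iff₀ hy]
    linarith
  nlinarith [sq_abs a, sq_nonneg (|a| - 1), abs_nonneg a]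

/-- The Gram determinant of a basis serves: it is nonzero because the form has no radical, and the
adjugate represents its multiples of functionals. -/
theorem exists_dualBound [Module.Free ℤ L] [Module.Finite ℤ L] {q : QuadraticForm ℤ L}
    (h : IsLorentzian (realBilin q)) {x : RealSpace L} (hx : 0 < realBilin q x x) :
    ∃ D : ℤ, D ≠ 0 ∧ DualBound q.polarBilin D := by
  have hb : ∀ x y, q.polarBilin x y = q.polarBilin y x := fun x y => QuadraticMap.polar_comm _ _ _
  set b := q.polarBilin with hbdef
  let e := Module.finBasis ℤ L
  refine ⟨(gram b e).det, fun hdet => ?_, fun f => ?_⟩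
  · obtain ⟨c, hc0, hc⟩ := Matrix.exists_mulVec_eq_zero_iff.mpr hdet
    have hev : ∀ j, b (e j) (∑ i, c i • e i) = 0 := by
      intro j
      have := congrFun hc j
      simp only [Matrix.mulVec, dotProduct, gram_apply, Pi.zero_apply] at this
      simp only [map_sum, map_smul, smul_eq_mul]
      rw [← this]
      exact Finset.sum_congr rfl fun i _ => mul_comm _ _
    have hev' : b.flip (∑ i, c i • e i) = 0 := e.ext fun j => hev j
    have hV : ∀ v, realBilin q v ((1 : ℝ) ⊗ₜ[ℤ] (∑ i, c i • e i)) = 0 := by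
      intro v
      induction v using TensorProduct.induction_on with
      | zero => simp
      | tmul a s =>
        have : b s (∑ i, c i • e i) = 0 := LinearMap.congr_fun hev' s
        rw [realBilin_tmul, ← hbdef, this]
        simp
      | add u v hu hv => rw [map_add, LinearMap.add_apply, hu, hv, add_zero]
    have h0 := one_tmul_eq_zero (h.separating hx hV)
    apply hc0
    ext i
    exact Fintype.linearIndependent_iff.mp e.linearIndependent c h0 i
  · obtain ⟨u, hu⟩ := det_smul_mem_range_pairing hb e fun i => f (e i)
    refine ⟨u, fun x => ?_⟩
    have : b u = (gram b e).det • f := e.ext fun j => congrFun hu j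
    rw [this]
    rfl

/-! ### The action on `V`, sign patterns and cells. -/

/-- The action of an automorphism of `L` on `V`. -/
abbrev realAct (g : L ≃ₗ[ℤ] L) : RealSpace L ≃ₗ[ℝ] RealSpace L :=
  LinearEquiv.baseChange ℤ ℝ L L g

theorem realAct_tmul (g : L ≃ₗ[ℤ] L) (a : ℝ) (s : L) :
    realAct g (a ⊗ₜ[ℤ] s) = a ⊗ₜ[ℤ] (g s) := by
  simp [realAct]

theorem realAct_mul (g h : L ≃ₗ[ℤ] L) (x : RealSpace L) :
    realAct (g * h) x = realAct g (realAct h x) := by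
  induction x using TensorProduct.induction_on with
  | zero => simp
  | tmul a s => simp
  | add u v hu hv => simp only [map_add, hu, hv]

theorem realAct_one (x : RealSpace L) : realAct (1 : L ≃ₗ[ℤ] L) x = x := by
  induction x using TensorProduct.induction_on with
  | zero => simp
  | tmul a s => simp
  | add u v hu hv => simp only [map_add, hu, hv]

theorem realAct_realAct_inv {q : QuadraticForm ℤ L} (g : orthogonalGroup q) (x : RealSpace L) :
    realAct (g : L ≃ₗ[ℤ] L) (realAct ((g⁻¹ : orthogonalGroup q) : L ≃ₗ[ℤ] L) x) = x := by
  rw [← realAct_mul, ← Subgroup.coe_mul, mul_inv_cancel, Subgroup.coe_one, realAct_one]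

theorem realBilin_realAct {q : QuadraticForm ℤ L} {g : L ≃ₗ[ℤ] L} (hg : g ∈ orthogonalGroup q)
    (x y : RealSpace L) : realBilin q (realAct g x) (realAct g y) = realBilin q x y := by
  have hg' : ∀ v, q (g v) = q v := hg
  induction x using TensorProduct.induction_on with
  | zero => simp
  | add u v hu hv => simp only [map_add, LinearMap.add_apply, hu, hv]
  | tmul a s =>
    induction y using TensorProduct.induction_on with
    | zero => simp
    | add u v hu hv => simp only [map_add, hu, hv]
    | tmul c t =>
      rw [realAct_tmul, realAct_tmul, realBilin_tmul, realBilin_tmul]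
      simp only [QuadraticMap.polarBilin_apply_apply, QuadraticMap.polar, ← map_add, hg']

/-- The sign of the pairing of `s ∈ L` with `x ∈ V`. -/
noncomputable def sgn (q : QuadraticForm ℤ L) (s : L) (x : RealSpace L) : SignType :=
  SignType.sign (realBilin q ((1 : ℝ) ⊗ₜ[ℤ] s) x)

theorem sgn_eq_zero {q : QuadraticForm ℤ L} {s : L} {x : RealSpace L} :
    sgn q s x = 0 ↔ realBilin q ((1 : ℝ) ⊗ₜ[ℤ] s) x = 0 :=
  sign_eq_zero_iff

theorem sgn_realAct {q : QuadraticForm ℤ L} {g : L ≃ₗ[ℤ] L} (hg : g ∈ orthogonalGroup q)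
    (s : L) (x : RealSpace L) : sgn q (g s) (realAct g x) = sgn q s x := by
  rw [sgn, ← realAct_tmul, realBilin_realAct hg, sgn]

/-- `x` and `y` lie in the same half of the light cone and on the same side of each hyperplane. -/
def SameCell (q : QuadraticForm ℤ L) (S : Set L) (x y : RealSpace L) : Prop :=
  0 < realBilin q x y ∧ ∀ s ∈ S, sgn q s x = sgn q s y

theorem SameCell.symm {q : QuadraticForm ℤ L} {S : Set L} {x y : RealSpace L}
    (h : SameCell q S x y) : SameCell q S y x :=
  ⟨by rw [realBilin_symm]; exact h.1, fun s hs => (h.2 s hs).symm⟩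

theorem SameCell.trans {q : QuadraticForm ℤ L} (hL : IsLorentzian (realBilin q)) {S : Set L}
    {x y z : RealSpace L} (hx : 0 < realBilin q x x) (hy : 0 < realBilin q y y)
    (hz : 0 < realBilin q z z) (h : SameCell q S x y) (h' : SameCell q S y z) :
    SameCell q S x z :=
  ⟨hL.pos_trans hx hy hz h.1 h'.1, fun s hs => (h.2 s hs).trans (h'.2 s hs)⟩

theorem SameCell.map {q : QuadraticForm ℤ L} {S : Set L} {g : orthogonalGroup q}
    (hg : ∀ s ∈ S, ((g⁻¹ : orthogonalGroup q) : L ≃ₗ[ℤ] L) s ∈ S) {x y : RealSpace L}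
    (h : SameCell q S x y) :
    SameCell q S (realAct (g : L ≃ₗ[ℤ] L) x) (realAct (g : L ≃ₗ[ℤ] L) y) := by
  refine ⟨by rw [realBilin_realAct g.2]; exact h.1, fun s hs => ?_⟩
  have h1 : s = (g : L ≃ₗ[ℤ] L) (((g⁻¹ : orthogonalGroup q) : L ≃ₗ[ℤ] L) s) := by
    change s = ((g * g⁻¹ : orthogonalGroup q) : L ≃ₗ[ℤ] L) s
    rw [mul_inv_cancel]
    rfl
  rw [h1, sgn_realAct g.2, sgn_realAct g.2]
  exact h.2 _ (hg s hs)

/-- The span of the members of `S` orthogonal to `x`. -/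
def zeroSpan (q : QuadraticForm ℤ L) (S : Set L) (x : RealSpace L) :
    Submodule ℝ (RealSpace L) :=
  Submodule.span ℝ ((fun s : L => (1 : ℝ) ⊗ₜ[ℤ] s) ''
    {s | s ∈ S ∧ realBilin q ((1 : ℝ) ⊗ₜ[ℤ] s) x = 0})

theorem realBilin_eq_zero_of_mem_span {q : QuadraticForm ℤ L} {A : Set (RealSpace L)}
    {x v : RealSpace L} (hA : ∀ a ∈ A, realBilin q a x = 0) (hv : v ∈ Submodule.span ℝ A) :
    realBilin q v x = 0 := by
  have : Submodule.span ℝ A ≤ LinearMap.ker ((realBilin q).flip x) :=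
    Submodule.span_le.mpr fun a ha => hA a ha
  exact this hv

/-! ### Boundary points, stars and finiteness of cells modulo `Γ`. -/

/-- A nonisolated cell has in its boundary a point of a smaller stratum. -/
theorem exists_boundary_point [Module.Free ℤ L] [Module.Finite ℤ L] {q : QuadraticForm ℤ L}
    (h : IsLorentzian (realBilin q)) {S : Set L} {N : ℤ} (hN : ∀ s ∈ S, -N ≤ q.polarBilin s s)
    {x y : RealSpace L} (hx : 0 < realBilin q x x) (hy : 0 < realBilin q y y)
    (hxy : 0 < realBilin q x y) (hS : ∀ s ∈ S, sgn q s x = 0 → sgn q s y = 0)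
    (hne : ¬ SameCell q S x y) :
    ∃ p, 0 < realBilin q p p ∧ 0 < realBilin q p x ∧
      Module.finrank ℝ (zeroSpan q S x) < Module.finrank ℝ (zeroSpan q S p) ∧
      ∀ s ∈ S, sgn q s p ≠ 0 → sgn q s p = sgn q s x := by
  let u : L → ℝ := fun s => realBilin q ((1 : ℝ) ⊗ₜ[ℤ] s) x
  let w : L → ℝ := fun s => realBilin q ((1 : ℝ) ⊗ₜ[ℤ] s) y
  have hsx : ∀ s, sgn q s x = SignType.sign (u s) := fun s => rfl
  have hsy : ∀ s, sgn q s y = SignType.sign (w s) := fun s => rfl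
  -- The hyperplanes that miss `x` and meet the segment from `x` to `y`. The segment meets `s^⊥` at
  -- parameter `u s / (u s - w s)`; the minimal parameter `t` gives `p`.
  let Z : Set L := {s | s ∈ S ∧ u s ≠ 0 ∧ u s * w s ≤ 0}
  have hZ : Z.Finite := (finite_separating h hx hy hxy N).subset
    fun s hs => ⟨hN s hs.1, hs.2.2⟩
  have hZne : Z.Nonempty := by
    by_contra hemp
    rw [Set.not_nonempty_iff_eq_empty] at hemp
    refine hne ⟨hxy, fun s hs => ?_⟩
    by_cases hu : u s = 0
    · have := sgn_eq_zero.mpr hu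
      rw [this, hS s hs this]
    · have hpos : 0 < u s * w s := by
        by_contra hle
        have : s ∈ Z := ⟨hs, hu, not_lt.mp hle⟩
        rw [hemp] at this
        exact this
      rw [hsx, hsy]
      rcases lt_or_gt_of_ne hu with hu | hu
      · rw [sign_neg hu, sign_neg (neg_of_mul_pos_right hpos hu.le)]
      · rw [sign_pos hu, sign_pos (pos_of_mul_pos_right hpos hu.le)]
  obtain ⟨s₀, ⟨hs₀S, hu₀, huw₀⟩, hmin⟩ := Set.exists_min_image Z (fun s => u s / (u s - w s)) hZ hZne
  have hfrac : ∀ s, u s ≠ 0 → u s * w s ≤ 0 → u s - w s ≠ 0 := by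
    intro s hu huw h0
    have : w s = u s := by linarith
    rw [this] at huw
    exact hu (by nlinarith)
  set t := u s₀ / (u s₀ - w s₀) with ht
  have hd₀ := hfrac s₀ hu₀ huw₀
  have hud : 0 < u s₀ * (u s₀ - w s₀) := by
    have : 0 < u s₀ * u s₀ := mul_self_pos.mpr hu₀
    nlinarith
  have ht0 : 0 < t := div_pos_iff.mpr (mul_pos_iff.mp hud)
  have ht1 : t ≤ 1 := by
    rcases pos_and_pos_or_neg_and_neg_of_mul_pos hud with ⟨h1, h2⟩ | ⟨h1, h2⟩
    · rw [ht, div_le_one h2]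
      nlinarith
    · rw [ht, div_le_one_of_neg h2]
      nlinarith
  let p := (1 - t) • x + t • y
  have hp : ∀ s, realBilin q ((1 : ℝ) ⊗ₜ[ℤ] s) p = u s - t * (u s - w s) := by
    intro s
    simp only [p, map_add, map_smul, smul_eq_mul, u, w]
    ring
  have hps : ∀ s, sgn q s p = SignType.sign (u s - t * (u s - w s)) := fun s => by
    rw [sgn, hp]
  refine ⟨p, h.combo_pos hx hy hxy (by linarith) ht0.le (by ring), ?_, ?_, ?_⟩
  · simp only [p, map_add, map_smul, LinearMap.add_apply, LinearMap.smul_apply, smul_eq_mul,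
      h.symm y x]
    nlinarith [mul_nonneg (sub_nonneg.mpr ht1) hx.le, mul_pos ht0 hxy]
  · have hp₀ : realBilin q ((1 : ℝ) ⊗ₜ[ℤ] s₀) p = 0 := by
      rw [hp, ht, div_mul_cancel₀ _ hd₀, sub_self]
    apply Submodule.finrank_lt_finrank_of_lt
    refine lt_of_le_of_ne (Submodule.span_mono (Set.image_mono ?_)) ?_
    · rintro s ⟨hs, hs0⟩
      have h1 : u s = 0 := hs0
      have h2 : w s = 0 := sgn_eq_zero.mp (hS s hs (sgn_eq_zero.mpr hs0))
      exact ⟨hs, by rw [hp, h1, h2]; ring⟩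
    · intro heq
      -- All of `zeroSpan q S x` is orthogonal to `x`, whereas `s₀` is not, so the span grows
      -- strictly.
      have hmem : (1 : ℝ) ⊗ₜ[ℤ] s₀ ∈ zeroSpan q S x := by
        rw [heq]
        exact Submodule.subset_span ⟨s₀, ⟨hs₀S, hp₀⟩, rfl⟩
      refine hu₀ (realBilin_eq_zero_of_mem_span ?_ hmem)
      rintro _ ⟨s, hs, rfl⟩
      exact hs.2
  · intro s hs hne0
    rw [hps] at hne0 ⊢
    rw [hsx]
    have hne0' : u s - t * (u s - w s) ≠ 0 := fun h0 => hne0 (by rw [h0, sign_zero])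
    by_cases hu : u s = 0
    · have h2 : w s = 0 := sgn_eq_zero.mp (hS s hs (sgn_eq_zero.mpr hu))
      exact absurd (by rw [hu, h2]; ring) hne0'
    have hprod : 0 ≤ u s * (u s - t * (u s - w s)) := by
      by_cases huw : u s * w s ≤ 0
      · have hd := hfrac s hu huw
        have hts : t ≤ u s / (u s - w s) := hmin s ⟨hs, hu, huw⟩
        have hud' : 0 < u s * (u s - w s) := by
          have : 0 < u s * u s := mul_self_pos.mpr hu
          nlinarith
        have h1 : t * (u s * (u s - w s)) ≤ u s / (u s - w s) * (u s * (u s - w s)) :=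
          mul_le_mul_of_nonneg_right hts hud'.le
        have h2 : u s / (u s - w s) * (u s * (u s - w s)) = u s * u s := by
          field_simp
        linarith
      · push Not at huw
        have h1 : 0 ≤ (1 - t) * (u s * u s) := mul_nonneg (by linarith) (mul_self_nonneg _)
        have h2 : 0 ≤ t * (u s * w s) := mul_nonneg ht0.le huw.le
        linarith
    have hprod' : 0 < u s * (u s - t * (u s - w s)) :=
      lt_of_le_of_ne hprod (mul_ne_zero hu hne0').symm
    rcases pos_and_pos_or_neg_and_neg_of_mul_pos hprod' with ⟨h1, h2⟩ | ⟨h1, h2⟩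
    · rw [sign_pos h1, sign_pos h2]
    · rw [sign_neg h1, sign_neg h2]

/-- Only finitely many cells have a given point in their closure. -/
theorem exists_finite_star [Module.Free ℤ L] [Module.Finite ℤ L] {q : QuadraticForm ℤ L}
    (h : IsLorentzian (realBilin q)) {S : Set L} {N : ℤ} (hN : ∀ s ∈ S, -N ≤ q.polarBilin s s)
    {p : RealSpace L} (hp : 0 < realBilin q p p) :
    ∃ T : Set (RealSpace L), T.Finite ∧ (∀ t ∈ T, 0 < realBilin q t t) ∧
      ∀ x, 0 < realBilin q x x → 0 < realBilin q p x →
        (∀ s ∈ S, sgn q s p ≠ 0 → sgn q s p = sgn q s x) → ∃ t ∈ T, SameCell q S x t := by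
  let A : Set L := {s | s ∈ S ∧ sgn q s p = 0}
  have hA : A.Finite := (finite_separating h hp hp hp N).subset fun s hs =>
    ⟨hN s hs.1, by rw [sgn_eq_zero.mp hs.2, mul_zero]⟩
  have : Finite A := hA
  let X : Set (RealSpace L) := {x | 0 < realBilin q x x ∧ 0 < realBilin q p x ∧
    ∀ s ∈ S, sgn q s p ≠ 0 → sgn q s p = sgn q s x}
  -- Signs off the finite set `A` are forced by `p`, so the finitely many sign patterns on `A`
  -- distinguish the cells.
  obtain ⟨T, hTX, hT, hrep⟩ := exists_finite_representatives X
    (fun x => fun s : A => sgn q s x) (Set.toFinite _)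
  refine ⟨T, hT, fun t ht => (hTX ht).1, fun x hx hpx hsx => ?_⟩
  obtain ⟨t, ht, hxt⟩ := hrep x ⟨hx, hpx, hsx⟩
  obtain ⟨htt, hpt, hst⟩ := hTX ht
  refine ⟨t, ht, h.pos_trans hx hp htt (by rwa [h.symm]) hpt, fun s hs => ?_⟩
  by_cases hs0 : sgn q s p = 0
  · exact congrFun hxt ⟨s, hs, hs0⟩
  · rw [← hsx s hs hs0, ← hst s hs hs0]

/-- Independent lattice vectors orthogonal to a positive vector have a nonsingular Gram matrix. -/
theorem det_gram_ne_zero_of_perp [Module.Free ℤ L] {q : QuadraticForm ℤ L}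
    (h : IsLorentzian (realBilin q)) {x : RealSpace L} (hx : 0 < realBilin q x x) {k : ℕ}
    {s : Fin k → L} (hs : ∀ i, realBilin q ((1 : ℝ) ⊗ₜ[ℤ] s i) x = 0)
    (hli : LinearIndependent ℝ fun i => ((1 : ℝ) ⊗ₜ[ℤ] s i : RealSpace L)) :
    (gram q.polarBilin s).det ≠ 0 := by
  intro hdet
  obtain ⟨c, hc0, hc⟩ := Matrix.exists_mulVec_eq_zero_iff.mpr hdet
  have hsum : (1 : ℝ) ⊗ₜ[ℤ] (∑ i, c i • s i)
      = ∑ i, (c i : ℝ) • ((1 : ℝ) ⊗ₜ[ℤ] s i : RealSpace L) := by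
    rw [TensorProduct.tmul_sum]
    refine Finset.sum_congr rfl fun i _ => ?_
    rw [TensorProduct.tmul_smul, Int.cast_smul_eq_zsmul]
  have hperp : realBilin q x ((1 : ℝ) ⊗ₜ[ℤ] (∑ i, c i • s i)) = 0 := by
    rw [hsum, map_sum]
    exact Finset.sum_eq_zero fun i _ => by rw [map_smul, h.symm, hs, smul_zero]
  have hself : realBilin q ((1 : ℝ) ⊗ₜ[ℤ] (∑ i, c i • s i)) ((1 : ℝ) ⊗ₜ[ℤ] (∑ i, c i • s i))
      = 0 := by
    rw [realBilin_tmul, bilin_sum_smul, hc]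
    simp
  have hzero : ((1 : ℝ) ⊗ₜ[ℤ] (∑ i, c i • s i) : RealSpace L) = 0 := by
    by_contra hne
    exact (h.neg _ _ hx hperp hne).ne hself
  rw [hsum] at hzero
  apply hc0
  ext i
  exact_mod_cast Fintype.linearIndependent_iff.mp hli _ hzero i

/-- Both vectors lie in the negative definite space `x^⊥`, where Cauchy–Schwarz applies and the
squares lie between `-N` and 0. -/
theorem abs_polar_le_of_perp {q : QuadraticForm ℤ L}
    (h : IsLorentzian (realBilin q)) {x : RealSpace L} (hx : 0 < realBilin q x x) {N : ℤ}
    {s t : L} (hs : realBilin q ((1 : ℝ) ⊗ₜ[ℤ] s) x = 0) (ht : realBilin q ((1 : ℝ) ⊗ₜ[ℤ] t) x = 0)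
    (hsN : -N ≤ q.polarBilin s s) (htN : -N ≤ q.polarBilin t t) :
    |q.polarBilin s t| ≤ N := by
  rw [h.symm] at hs ht
  have h1 := h.sq_le_of_perp hx hs ht
  have h2 := h.nonpos hx hs
  have h3 := h.nonpos hx ht
  simp only [realBilin_tmul, one_mul] at h1 h2 h3
  have h1' : q.polarBilin s t ^ 2 ≤ q.polarBilin s s * q.polarBilin t t := by exact_mod_cast h1
  have h2' : q.polarBilin s s ≤ 0 := by exact_mod_cast h2
  have h3' : q.polarBilin t t ≤ 0 := by exact_mod_cast h3
  apply abs_le_of_sq_le_sq _ (by linarith)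
  nlinarith

/-- The isolated cells, those filling a whole stratum of given codimension, form finitely many
orbits. -/
theorem exists_finite_isolated_cells [Module.Free ℤ L] [Module.Finite ℤ L] {q : QuadraticForm ℤ L}
    (h : IsLorentzian (realBilin q)) {Γ : Subgroup (orthogonalGroup q)} (hΓ : Γ.FiniteIndex)
    {S : Set L} {N : ℤ} (hN : ∀ s ∈ S, -N ≤ q.polarBilin s s) (k : ℕ) :
    ∃ T : Set (RealSpace L), T.Finite ∧ (∀ t ∈ T, 0 < realBilin q t t) ∧
      ∀ x, 0 < realBilin q x x → Module.finrank ℝ (zeroSpan q S x) = k →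
        (∀ y, 0 < realBilin q y y → 0 < realBilin q x y →
          (∀ s ∈ S, sgn q s x = 0 → sgn q s y = 0) → SameCell q S x y) →
        ∃ t ∈ T, ∃ γ ∈ Γ, SameCell q S x (realAct (γ : L ≃ₗ[ℤ] L) t) := by
  by_cases hk : (∃ x, 0 < realBilin q x x) ∧ k ≤ Module.finrank ℤ L
  swap
  · refine ⟨∅, Set.finite_empty, by simp, fun x hx hxk => absurd ⟨⟨x, hx⟩, ?_⟩ hk⟩
    have hrank : Module.finrank ℝ (RealSpace L) = Module.finrank ℤ L := Module.finrank_baseChange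
    rw [← hxk, ← hrank]
    exact Submodule.finrank_le _
  obtain ⟨⟨x₀, hx₀⟩, hk⟩ := hk
  obtain ⟨D, hD, hdual⟩ := exists_dualBound h hx₀
  obtain ⟨R, hR, hrep⟩ := exists_finite_tuples q hD hdual Γ hΓ hk N
  have hchoice : ∀ r : Fin k → L, ∃ y, (∃ z, 0 < realBilin q z z ∧ ∀ i, sgn q (r i) z = 0) →
      0 < realBilin q y y ∧ ∀ i, sgn q (r i) y = 0 := fun r => by
    by_cases hz : ∃ z, 0 < realBilin q z z ∧ ∀ i, sgn q (r i) z = 0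
    · obtain ⟨z, hz'⟩ := hz
      exact ⟨z, fun _ => hz'⟩
    · exact ⟨0, fun h => absurd h hz⟩
  choose Y hY using hchoice
  -- Both signs are kept, since the translate of `Y r` may fall in the half of the light cone
  -- opposite to `x`.
  let T := (Y '' R ∪ (fun r => -Y r) '' R) ∩ {t | 0 < realBilin q t t}
  refine ⟨T, ((hR.image _).union (hR.image _)).inter_of_left _, fun t ht => ht.2,
    fun x hx hxk hiso => ?_⟩
  subst hxk
  obtain ⟨f, hfmem, hfspan, hfli⟩ := Submodule.exists_fun_fin_finrank_span_eq ℝ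
    ((fun s : L => ((1 : ℝ) ⊗ₜ[ℤ] s : RealSpace L)) ''
      {s | s ∈ S ∧ realBilin q ((1 : ℝ) ⊗ₜ[ℤ] s) x = 0})
  choose s hs hsf using hfmem
  have hsf' : f = fun i => (1 : ℝ) ⊗ₜ[ℤ] s i := funext fun i => (hsf i).symm
  obtain ⟨r, hr, γ, hγ, hsr⟩ := hrep s
    (det_gram_ne_zero_of_perp h hx (fun i => (hs i).2) (hsf' ▸ hfli))
    (fun i j => abs_polar_le_of_perp h hx (hs i).2 (hs j).2 (hN _ (hs i).1) (hN _ (hs j).1))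
  have hinv := realAct_realAct_inv γ
  obtain ⟨hYpos, hYr⟩ := hY r ⟨realAct ((γ⁻¹ : orthogonalGroup q) : L ≃ₗ[ℤ] L) x, by
      rw [realBilin_realAct (γ⁻¹).2]; exact hx, fun i => by
      rw [← sgn_realAct γ.2, hinv, ← hsr, sgn_eq_zero]
      exact (hs i).2⟩
  have hy : ∀ s' ∈ S, sgn q s' x = 0 → sgn q s' (realAct (γ : L ≃ₗ[ℤ] L) (Y r)) = 0 := by
    intro s' hs' hs0
    rw [sgn_eq_zero] at hs0 ⊢
    have hmem : (1 : ℝ) ⊗ₜ[ℤ] s' ∈ Submodule.span ℝ (Set.range f) := by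
      rw [hfspan]
      exact Submodule.subset_span ⟨s', ⟨hs', hs0⟩, rfl⟩
    refine realBilin_eq_zero_of_mem_span ?_ hmem
    rintro _ ⟨i, rfl⟩
    rw [← hsf, ← sgn_eq_zero]
    refine (congrArg (sgn q · _) (hsr i)).trans ?_
    rw [sgn_realAct γ.2]
    exact hYr i
  have hypos : 0 < realBilin q (realAct (γ : L ≃ₗ[ℤ] L) (Y r)) (realAct (γ : L ≃ₗ[ℤ] L) (Y r)) := by
    rwa [realBilin_realAct γ.2]
  rcases lt_or_gt_of_ne (h.ne_zero hx hypos) with hlt | hgt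
  · refine ⟨-Y r, ⟨Or.inr ⟨r, hr, rfl⟩, by simpa using hYpos⟩, γ, hγ, ?_⟩
    rw [map_neg]
    refine hiso _ (by simpa using hypos) (by simpa using hlt) fun s' hs' hs0 => ?_
    have := hy s' hs' hs0
    rw [sgn_eq_zero] at this ⊢
    rw [map_neg, this, neg_zero]
  · exact ⟨Y r, ⟨Or.inl ⟨r, hr, rfl⟩, hYpos⟩, γ, hγ, hiso _ hypos hgt hy⟩

/-- Finitely many orbits of cells. -/
theorem exists_finite_cells [Module.Free ℤ L] [Module.Finite ℤ L] {q : QuadraticForm ℤ L}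
    (h : IsLorentzian (realBilin q)) {Γ : Subgroup (orthogonalGroup q)} (hΓ : Γ.FiniteIndex)
    {S : Set L} (hS : ∀ γ ∈ Γ, ∀ s ∈ S, (γ : L ≃ₗ[ℤ] L) s ∈ S) {N : ℤ}
    (hN : ∀ s ∈ S, -N ≤ q.polarBilin s s) :
    ∃ T : Set (RealSpace L), T.Finite ∧ (∀ t ∈ T, 0 < realBilin q t t) ∧
      ∀ x, 0 < realBilin q x x →
        ∃ t ∈ T, ∃ γ ∈ Γ, SameCell q S x (realAct (γ : L ≃ₗ[ℤ] L) t) := by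
  -- Level `j` treats the cells whose normals have rank greater than `dim V - j`; level 0 is empty
  -- and level `dim V + 1` contains every cell.
  suffices H : ∀ j : ℕ, ∃ T : Set (RealSpace L), T.Finite ∧ (∀ t ∈ T, 0 < realBilin q t t) ∧
      ∀ x, 0 < realBilin q x x →
        Module.finrank ℝ (RealSpace L) < Module.finrank ℝ (zeroSpan q S x) + j →
        ∃ t ∈ T, ∃ γ ∈ Γ, SameCell q S x (realAct (γ : L ≃ₗ[ℤ] L) t) by
    obtain ⟨T, hT, hpos, hrep⟩ := H (Module.finrank ℝ (RealSpace L) + 1)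
    exact ⟨T, hT, hpos, fun x hx => hrep x hx (by omega)⟩
  intro j
  induction j with
  | zero =>
    refine ⟨∅, Set.finite_empty, by simp, fun x hx hlt => ?_⟩
    have := Submodule.finrank_le (zeroSpan q S x)
    omega
  | succ j ih =>
    obtain ⟨T₀, hT₀, hpos₀, hrep₀⟩ := ih
    obtain ⟨T₁, hT₁, hpos₁, hrep₁⟩ := exists_finite_isolated_cells h hΓ hN
      (Module.finrank ℝ (RealSpace L) - j)
    have hstar : ∀ p, ∃ T : Set (RealSpace L), 0 < realBilin q p p →
        T.Finite ∧ (∀ t ∈ T, 0 < realBilin q t t) ∧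
        ∀ x, 0 < realBilin q x x → 0 < realBilin q p x →
          (∀ s ∈ S, sgn q s p ≠ 0 → sgn q s p = sgn q s x) → ∃ t ∈ T, SameCell q S x t := by
      intro p
      by_cases hp : 0 < realBilin q p p
      · obtain ⟨T, hT⟩ := exists_finite_star h hN hp
        exact ⟨T, fun _ => hT⟩
      · exact ⟨∅, fun h => absurd h hp⟩
    choose F hF using hstar
    refine ⟨T₀ ∪ T₁ ∪ ⋃ p ∈ T₀, F p, (hT₀.union hT₁).union
      (hT₀.biUnion fun p hp => (hF p (hpos₀ p hp)).1), ?_, fun x hx hlt => ?_⟩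
    · rintro t ((ht | ht) | ht)
      · exact hpos₀ t ht
      · exact hpos₁ t ht
      · simp only [Set.mem_iUnion] at ht
        obtain ⟨p, hp, ht⟩ := ht
        exact (hF p (hpos₀ p hp)).2.1 t ht
    by_cases hlt' : Module.finrank ℝ (RealSpace L) < Module.finrank ℝ (zeroSpan q S x) + j
    · obtain ⟨t, ht, hγ⟩ := hrep₀ x hx hlt'
      exact ⟨t, Or.inl (Or.inl ht), hγ⟩
    by_cases hiso : ∀ y, 0 < realBilin q y y → 0 < realBilin q x y →
          (∀ s ∈ S, sgn q s x = 0 → sgn q s y = 0) → SameCell q S x y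
    · obtain ⟨t, ht, hγ⟩ := hrep₁ x hx (by omega) hiso
      exact ⟨t, Or.inl (Or.inr ht), hγ⟩
    push Not at hiso
    obtain ⟨y, hy, hxy, hxyS, hne⟩ := hiso
    -- The normals at `p` have larger rank, so `p` is in the cell of some `γ t` with `t ∈ T₀`. Then
    -- `γ⁻¹ x` lies in the star of `t`, whose finitely many cells are represented by `F t`.
    obtain ⟨p, hp, hpx, hrank, hsgn⟩ := exists_boundary_point h hN hx hy hxy hxyS hne
    obtain ⟨t, ht, γ, hγ, hcell⟩ := hrep₀ p hp (by omega)
    have hinv := realAct_realAct_inv γ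
    have htpos := hpos₀ t ht
    have htpos' : 0 < realBilin q (realAct (γ : L ≃ₗ[ℤ] L) t) (realAct (γ : L ≃ₗ[ℤ] L) t) := by
      rwa [realBilin_realAct γ.2]
    obtain ⟨t', ht', hcell'⟩ := (hF t htpos).2.2
      (realAct ((γ⁻¹ : orthogonalGroup q) : L ≃ₗ[ℤ] L) x)
      (by rw [realBilin_realAct (γ⁻¹).2]; exact hx)
      (by
        rw [← realBilin_realAct γ.2, hinv]
        exact h.pos_trans htpos' hp hx hcell.symm.1 hpx)
      (by
        intro s hs hs0
        have hγs := hS γ hγ s hs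
        rw [← sgn_realAct γ.2, ← hcell.2 _ hγs] at hs0 ⊢
        rw [← sgn_realAct γ.2 s, hinv]
        exact hsgn _ hγs hs0)
    have := hcell'.map (g := γ) fun s hs => hS _ (Γ.inv_mem hγ) s hs
    rw [hinv] at this
    refine ⟨t', Or.inr ?_, γ, hγ, this⟩
    simp only [Set.mem_iUnion]
    exact ⟨t, ht, ht'⟩

/-! ### Cells as subsets of projective space. -/

instance : IsModuleTopology ℝ (RealSpace L) := ⟨rfl⟩

theorem SameCell.smul {q : QuadraticForm ℤ L} {S : Set L} {x y : RealSpace L}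
    (h : SameCell q S x y) {c : ℝ} (hc : c ≠ 0) : SameCell q S (c • x) (c • y) := by
  refine ⟨?_, fun s hs => ?_⟩
  · simp only [map_smul, LinearMap.smul_apply, smul_eq_mul]
    rw [← mul_assoc]
    exact mul_pos (mul_self_pos.mpr hc) h.1
  · have := h.2 s hs
    simp only [sgn, map_smul, smul_eq_mul, sign_mul] at this ⊢
    rw [this]

/-- The cell of `x`, as a subset of the hyperbolic space. -/
def cell (q : QuadraticForm ℤ L) (S : Set L) (x : RealSpace L) : Set (ℙ ℝ (RealSpace L)) :=
  {p | 0 < realBilin q p.rep p.rep ∧ ∃ c : ℝ, SameCell q S (c • p.rep) x}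

theorem realBilin_smul_smul (q : QuadraticForm ℤ L) (c : ℝ) (x : RealSpace L) :
    realBilin q (c • x) (c • x) = c ^ 2 * realBilin q x x := by
  simp only [map_smul, LinearMap.smul_apply, smul_eq_mul]
  ring

theorem realBilin_smul_pos {q : QuadraticForm ℤ L} {c : ℝ} (hc : c ≠ 0) {x : RealSpace L} :
    0 < realBilin q (c • x) (c • x) ↔ 0 < realBilin q x x := by
  rw [realBilin_smul_smul, mul_pos_iff_of_pos_left (by positivity)]

theorem SameCell.left_ne_zero {q : QuadraticForm ℤ L} {S : Set L} {c : ℝ} {v x : RealSpace L}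
    (h : SameCell q S (c • v) x) : c ≠ 0 := by
  rintro rfl
  have := h.1
  simp at this

theorem mk_mem_cell {q : QuadraticForm ℤ L} {S : Set L} {v x : RealSpace L} (hv : v ≠ 0) :
    Projectivization.mk ℝ v hv ∈ cell q S x ↔
      0 < realBilin q v v ∧ ∃ c : ℝ, SameCell q S (c • v) x := by
  obtain ⟨a, ha⟩ := Projectivization.exists_smul_eq_mk_rep ℝ v hv
  have ha' : (Projectivization.mk ℝ v hv).rep = (a : ℝ) • v := ha.symm
  rw [cell, Set.mem_ofPred_eq, ha', realBilin_smul_pos a.ne_zero]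
  refine and_congr_right fun _ => ⟨fun ⟨c, hc⟩ => ⟨c * a, by rwa [mul_smul]⟩, fun ⟨c, hc⟩ =>
    ⟨c * (a : ℝ)⁻¹, ?_⟩⟩
  rwa [smul_smul, mul_assoc, inv_mul_cancel₀ a.ne_zero, mul_one]

theorem rep_mem_cell {q : QuadraticForm ℤ L} {S : Set L} {p : ℙ ℝ (RealSpace L)}
    (hp : 0 < realBilin q p.rep p.rep) : p ∈ cell q S p.rep :=
  ⟨hp, 1, by rw [one_smul]; exact ⟨hp, fun _ _ => rfl⟩⟩

theorem cell_eq_of_sameCell {q : QuadraticForm ℤ L} (h : IsLorentzian (realBilin q)) {S : Set L}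
    {x y : RealSpace L} (hx : 0 < realBilin q x x) (hy : 0 < realBilin q y y)
    (hxy : SameCell q S x y) : cell q S x = cell q S y := by
  ext p
  refine and_congr_right fun hp => exists_congr fun c => ⟨fun hc => ?_, fun hc => ?_⟩
  · exact hc.trans h ((realBilin_smul_pos hc.left_ne_zero).mpr hp) hx hy hxy
  · exact hc.trans h ((realBilin_smul_pos hc.left_ne_zero).mpr hp) hy hx hxy.symm

theorem cell_smul {q : QuadraticForm ℤ L} {S : Set L} {c : ℝ} (hc : c ≠ 0) (x : RealSpace L) :
    cell q S (c • x) = cell q S x := by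
  ext p
  refine and_congr_right fun hp => ⟨fun ⟨a, ha⟩ => ⟨c⁻¹ * a, ?_⟩, fun ⟨a, ha⟩ => ⟨c * a, ?_⟩⟩
  · have := ha.smul (inv_ne_zero hc)
    rwa [smul_smul, smul_smul, inv_mul_cancel₀ hc, one_smul] at this
  · rw [mul_smul]
    exact ha.smul hc

theorem cell_rep_eq {q : QuadraticForm ℤ L} (h : IsLorentzian (realBilin q)) {S : Set L}
    {p : ℙ ℝ (RealSpace L)} {x : RealSpace L} (hx : 0 < realBilin q x x)
    (hp : p ∈ cell q S x) : cell q S p.rep = cell q S x := by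
  obtain ⟨hpos, c, hc⟩ := hp
  rw [← cell_smul hc.left_ne_zero p.rep]
  exact cell_eq_of_sameCell h ((realBilin_smul_pos hc.left_ne_zero).mpr hpos) hx hc

theorem projAct_mk (g : L ≃ₗ[ℤ] L) (v : RealSpace L) (hv : v ≠ 0) :
    projAct g (Projectivization.mk ℝ v hv)
      = Projectivization.mk ℝ (realAct g v) ((realAct g).map_ne_zero_iff.mpr hv) :=
  rfl

theorem projAct_mem_cell {q : QuadraticForm ℤ L} {S : Set L} {g : orthogonalGroup q}
    (hg : ∀ s ∈ S, ((g⁻¹ : orthogonalGroup q) : L ≃ₗ[ℤ] L) s ∈ S) {x : RealSpace L}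
    {p : ℙ ℝ (RealSpace L)} (hp : p ∈ cell q S x) :
    projAct (g : L ≃ₗ[ℤ] L) p ∈ cell q S (realAct (g : L ≃ₗ[ℤ] L) x) := by
  induction p using Projectivization.ind with
  | h v hv =>
    rw [mk_mem_cell] at hp
    obtain ⟨hpos, c, hc⟩ := hp
    rw [projAct_mk, mk_mem_cell, realBilin_realAct g.2]
    refine ⟨hpos, c, ?_⟩
    rw [← map_smul]
    exact hc.map hg

theorem projAct_projAct_inv {q : QuadraticForm ℤ L} (g : orthogonalGroup q)
    (p : ℙ ℝ (RealSpace L)) :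
    projAct (g : L ≃ₗ[ℤ] L) (projAct ((g⁻¹ : orthogonalGroup q) : L ≃ₗ[ℤ] L) p) = p := by
  induction p using Projectivization.ind with
  | h v hv =>
    rw [projAct_mk, projAct_mk]
    congr 1
    exact realAct_realAct_inv g v

theorem image_cell {q : QuadraticForm ℤ L} {Γ : Subgroup (orthogonalGroup q)} {S : Set L}
    (hS : ∀ γ ∈ Γ, ∀ s ∈ S, (γ : L ≃ₗ[ℤ] L) s ∈ S) {γ : orthogonalGroup q} (hγ : γ ∈ Γ)
    (x : RealSpace L) :
    projAct (γ : L ≃ₗ[ℤ] L) '' cell q S x = cell q S (realAct (γ : L ≃ₗ[ℤ] L) x) := by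
  refine Set.Subset.antisymm ?_ fun p hp => ?_
  · rintro _ ⟨p, hp, rfl⟩
    exact projAct_mem_cell (hS _ (Γ.inv_mem hγ)) hp
  · refine ⟨projAct ((γ⁻¹ : orthogonalGroup q) : L ≃ₗ[ℤ] L) p, ?_, projAct_projAct_inv γ p⟩
    have := projAct_mem_cell (g := γ⁻¹) (by rw [inv_inv]; exact hS _ hγ) hp
    have hinv := realAct_realAct_inv γ⁻¹ x
    rw [inv_inv] at hinv
    rwa [hinv] at this

/-! ### Strata, and the identification of faces with cells. -/

/-- The vector `x` lies on some stratum of codimension `k` but on none of codimension `k + 1`. -/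
structure OnStratum (q : QuadraticForm ℤ L) (S : Set L) (k : ℕ) (x : RealSpace L) : Prop where
  pos : 0 < realBilin q x x
  exists_tuple : ∃ s : Fin k → L, (∀ i, s i ∈ S) ∧
    LinearIndependent ℝ (fun i => ((1 : ℝ) ⊗ₜ[ℤ] s i : RealSpace L)) ∧
    ∀ i, realBilin q ((1 : ℝ) ⊗ₜ[ℤ] s i) x = 0
  not_exists_tuple : ∀ s : Fin (k + 1) → L, (∀ i, s i ∈ S) →
    LinearIndependent ℝ (fun i => ((1 : ℝ) ⊗ₜ[ℤ] s i : RealSpace L)) →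
    ¬ ∀ i, realBilin q ((1 : ℝ) ⊗ₜ[ℤ] s i) x = 0

theorem OnStratum.of_cell {q : QuadraticForm ℤ L} {S : Set L} {k : ℕ} {x : RealSpace L}
    (h : OnStratum q S k x) {p : ℙ ℝ (RealSpace L)} (hp : p ∈ cell q S x) :
    OnStratum q S k p.rep := by
  obtain ⟨hpos, c, hc⟩ := hp
  have hzero : ∀ s ∈ S, (realBilin q ((1 : ℝ) ⊗ₜ[ℤ] s) p.rep = 0 ↔
      realBilin q ((1 : ℝ) ⊗ₜ[ℤ] s) x = 0) := by
    intro s hs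
    rw [← sgn_eq_zero (x := x), ← hc.2 s hs, sgn_eq_zero, map_smul, smul_eq_mul, mul_eq_zero,
      or_iff_right hc.left_ne_zero]
  obtain ⟨s, hs, hli, h0⟩ := h.exists_tuple
  exact ⟨hpos, ⟨s, hs, hli, fun i => (hzero _ (hs i)).mpr (h0 i)⟩,
    fun s' hs' hli' h0' => h.not_exists_tuple s' hs' hli' fun i => (hzero _ (hs' i)).mp (h0' i)⟩

theorem linearIndependent_realAct (g : L ≃ₗ[ℤ] L) {k : ℕ} {s : Fin k → L}
    (h : LinearIndependent ℝ (fun i => ((1 : ℝ) ⊗ₜ[ℤ] s i : RealSpace L))) :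
    LinearIndependent ℝ (fun i => ((1 : ℝ) ⊗ₜ[ℤ] g (s i) : RealSpace L)) := by
  have := h.map' (realAct g).toLinearMap (LinearEquiv.ker _)
  have heq : (fun i => ((1 : ℝ) ⊗ₜ[ℤ] g (s i) : RealSpace L))
      = (realAct g).toLinearMap ∘ fun i => (1 : ℝ) ⊗ₜ[ℤ] s i :=
    funext fun i => (realAct_tmul g 1 (s i)).symm
  rw [heq]
  exact this

theorem OnStratum.map {q : QuadraticForm ℤ L} {Γ : Subgroup (orthogonalGroup q)} {S : Set L}
    (hS : ∀ γ ∈ Γ, ∀ s ∈ S, (γ : L ≃ₗ[ℤ] L) s ∈ S) {γ : orthogonalGroup q} (hγ : γ ∈ Γ)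
    {k : ℕ} {x : RealSpace L} (h : OnStratum q S k x) :
    OnStratum q S k (realAct (γ : L ≃ₗ[ℤ] L) x) := by
  obtain ⟨s, hs, hli, h0⟩ := h.exists_tuple
  refine ⟨by rw [realBilin_realAct γ.2]; exact h.pos, ⟨fun i => (γ : L ≃ₗ[ℤ] L) (s i),
    fun i => hS γ hγ _ (hs i), linearIndependent_realAct _ hli, fun i => ?_⟩,
    fun s' hs' hli' h0' => ?_⟩
  · rw [← realAct_tmul, realBilin_realAct γ.2, h0]
  · refine h.not_exists_tuple (fun i => ((γ⁻¹ : orthogonalGroup q) : L ≃ₗ[ℤ] L) (s' i))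
      (fun i => hS _ (Γ.inv_mem hγ) _ (hs' i)) (linearIndependent_realAct _ hli') fun i => ?_
    rw [← realAct_tmul, ← realBilin_realAct γ.2, realAct_realAct_inv]
    exact h0' i

theorem mem_hypSubspace_iInf_perp {q : QuadraticForm ℤ L} {k : ℕ} {s : Fin k → L}
    {p : ℙ ℝ (RealSpace L)} :
    p ∈ hypSubspace q (⨅ i, perp q (s i)) ↔
      0 < realBilin q p.rep p.rep ∧ ∀ i, realBilin q ((1 : ℝ) ⊗ₜ[ℤ] s i) p.rep = 0 := by
  rw [hypSubspace, Set.mem_ofPred_eq, hyperbolicSpace, Set.mem_ofPred_eq, realBilin_self,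
    Submodule.mem_iInf]
  refine and_congr ⟨fun h => by linarith, fun h => by linarith⟩ (forall_congr' fun i => ?_)
  rw [perp, LinearMap.mem_ker]

theorem mem_openStratum_iff {q : QuadraticForm ℤ L} {S : Set L} {k : ℕ} {s : Fin k → L}
    (hs : ∀ i, s i ∈ S)
    (hli : LinearIndependent ℝ (fun i => ((1 : ℝ) ⊗ₜ[ℤ] s i : RealSpace L)))
    {p : ℙ ℝ (RealSpace L)} :
    p ∈ hypSubspace q (⨅ i, perp q (s i)) \ ⋃ W' ∈ flats q S (k + 1), hypSubspace q W' ↔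
      OnStratum q S k p.rep ∧ ∀ i, realBilin q ((1 : ℝ) ⊗ₜ[ℤ] s i) p.rep = 0 := by
  rw [Set.mem_sdiff, mem_hypSubspace_iInf_perp]
  constructor
  · rintro ⟨⟨hpos, h0⟩, hnot⟩
    refine ⟨⟨hpos, ⟨s, hs, hli, h0⟩, fun s' hs' hli' h0' => hnot ?_⟩, h0⟩
    simp only [Set.mem_iUnion]
    exact ⟨_, ⟨s', hs', hli', rfl⟩, mem_hypSubspace_iInf_perp.mpr ⟨hpos, h0'⟩⟩
  · rintro ⟨hst, h0⟩
    refine ⟨⟨hst.pos, h0⟩, fun hmem => ?_⟩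
    simp only [Set.mem_iUnion] at hmem
    obtain ⟨W', ⟨s', hs', hli', rfl⟩, hmem⟩ := hmem
    exact hst.not_exists_tuple s' hs' hli' (mem_hypSubspace_iInf_perp.mp hmem).2

/-- A normal `t` orthogonal to `x` but outside the span would extend `s` to a transversal tuple of
length `k + 1`. The right-hand side does not involve `x`, so all points of one open stratum lie on
the same hyperplanes. -/
theorem OnStratum.eq_zero_iff {q : QuadraticForm ℤ L} {S : Set L} {k : ℕ} {x : RealSpace L}
    (h : OnStratum q S k x) {s : Fin k → L} (hs : ∀ i, s i ∈ S)
    (hli : LinearIndependent ℝ (fun i => ((1 : ℝ) ⊗ₜ[ℤ] s i : RealSpace L)))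
    (h0 : ∀ i, realBilin q ((1 : ℝ) ⊗ₜ[ℤ] s i) x = 0) {t : L} (ht : t ∈ S) :
    realBilin q ((1 : ℝ) ⊗ₜ[ℤ] t) x = 0 ↔
      (1 : ℝ) ⊗ₜ[ℤ] t ∈ Submodule.span ℝ
        (Set.range fun i => ((1 : ℝ) ⊗ₜ[ℤ] s i : RealSpace L)) := by
  refine ⟨fun ht0 => ?_, fun hmem => realBilin_eq_zero_of_mem_span ?_ hmem⟩
  · by_contra hmem
    refine h.not_exists_tuple (Fin.cons t s) (fun i => ?_) ?_ fun i => ?_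
    · refine Fin.cases ht hs i
    · have := linearIndependent_finCons.mpr ⟨hli, hmem⟩
      have heq : (fun i => ((1 : ℝ) ⊗ₜ[ℤ] (Fin.cons t s : Fin (k + 1) → L) i : RealSpace L))
          = Fin.cons ((1 : ℝ) ⊗ₜ[ℤ] t) fun i => (1 : ℝ) ⊗ₜ[ℤ] s i :=
        funext fun i => Fin.cases rfl (fun i => rfl) i
      rw [heq]
      exact this
    · refine Fin.cases ht0 h0 i
  · rintro _ ⟨i, rfl⟩
    exact h0 i

theorem sign_combo {u w a c : ℝ} (h : SignType.sign u = SignType.sign w) (ha : 0 ≤ a)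
    (hc : 0 ≤ c) (hac : a + c = 1) : SignType.sign (a * u + c * w) = SignType.sign w := by
  rcases lt_trichotomy w 0 with hw | rfl | hw
  · rw [sign_neg hw, sign_eq_neg_one_iff] at h ⊢
    rcases ha.eq_or_lt with rfl | ha
    · obtain rfl : c = 1 := by linarith
      linarith
    · nlinarith [mul_neg_of_pos_of_neg ha h, mul_nonpos_of_nonneg_of_nonpos hc hw.le]
  · rw [sign_zero, sign_eq_zero_iff] at h
    simp [h]
  · rw [sign_pos hw, sign_eq_one_iff] at h ⊢
    rcases ha.eq_or_lt with rfl | ha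
    · obtain rfl : c = 1 := by linarith
      linarith
    · nlinarith [mul_pos ha h, mul_nonneg hc hw.le]

/-- The cell is the continuous image of a convex set of vectors in one half of the light cone. -/
theorem isPreconnected_cell {q : QuadraticForm ℤ L} (h : IsLorentzian (realBilin q)) {S : Set L}
    {x : RealSpace L} (hx : 0 < realBilin q x x) : IsPreconnected (cell q S x) := by
  let C : Set (RealSpace L) := {v | 0 < realBilin q v v ∧ SameCell q S v x}
  have hC : Convex ℝ C := by
    rintro v ⟨hv, hvx⟩ w ⟨hw, hwx⟩ a c ha hc hac
    have hvw := hvx.trans h hv hx hw hwx.symm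
    have hpos := h.combo_pos hv hw hvw.1 ha hc hac
    refine ⟨hpos, ?_, fun s hs => ?_⟩
    · have h1 := hvx.1
      have h2 := hwx.1
      simp only [map_add, map_smul, LinearMap.add_apply, LinearMap.smul_apply, smul_eq_mul]
      rcases ha.eq_or_lt with rfl | ha
      · obtain rfl : c = 1 := by linarith
        linarith
      · nlinarith [mul_pos ha h1, mul_nonneg hc h2.le]
    · rw [← hwx.2 s hs]
      have := hvw.2 s hs
      simp only [sgn, map_add, map_smul, smul_eq_mul] at this ⊢
      exact sign_combo this ha hc hac
  have hne : ∀ v ∈ C, v ≠ 0 := by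
    rintro v ⟨hv, -⟩ rfl
    simp at hv
  have : IsTopologicalAddGroup (RealSpace L) := IsModuleTopology.topologicalAddGroup ℝ _
  have : ContinuousSMul ℝ (RealSpace L) := IsModuleTopology.toContinuousSMul ℝ _
  let C' : Set {v : RealSpace L // v ≠ 0} := {v | v.1 ∈ C}
  have hC' : IsPreconnected C' := by
    have hind : Topology.IsInducing (Subtype.val : {v : RealSpace L // v ≠ 0} → RealSpace L) :=
      ⟨rfl⟩
    rw [← hind.isPreconnected_image]
    have : Subtype.val '' C' = C := by
      ext v
      exact ⟨fun ⟨w, hw, hwv⟩ => hwv ▸ hw, fun hv => ⟨⟨v, hne v hv⟩, hv, rfl⟩⟩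
    rw [this]
    exact hC.isPreconnected
  have himg : (fun v : {v : RealSpace L // v ≠ 0} => Projectivization.mk ℝ v.1 v.2) '' C'
      = cell q S x := by
    ext p
    constructor
    · rintro ⟨v, ⟨hv, hvx⟩, rfl⟩
      exact (mk_mem_cell v.2).mpr ⟨hv, 1, by rwa [one_smul]⟩
    · rintro ⟨hp, c, hc⟩
      have hc0 := hc.left_ne_zero
      refine ⟨⟨c • p.rep, smul_ne_zero hc0 p.rep_nonzero⟩,
        ⟨(realBilin_smul_pos hc0).mpr hp, hc⟩, ?_⟩
      conv_rhs => rw [← p.mk_rep]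
      exact (Projectivization.mk_eq_mk_iff' ℝ _ _ _ _).mpr ⟨c, rfl⟩
  rw [← himg]
  exact hC'.image _ continuous_coinduced_rng.continuousOn

/-- A product of two functionals is homogeneous of degree 2, so its sign does not depend on the
representative of a line, although the sign of a single functional does. -/
theorem isOpen_pairing_pos (B₁ B₂ : RealSpace L →ₗ[ℝ] ℝ) :
    IsOpen {p : ℙ ℝ (RealSpace L) | 0 < B₁ p.rep * B₂ p.rep} := by
  rw [isOpen_coinduced]
  have h1 : Continuous B₁ := IsModuleTopology.continuous_of_linearMap B₁
  have h2 : Continuous B₂ := IsModuleTopology.continuous_of_linearMap B₂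
  have : (fun v : {v : RealSpace L // v ≠ 0} => Projectivization.mk ℝ v.1 v.2) ⁻¹'
      {p : ℙ ℝ (RealSpace L) | 0 < B₁ p.rep * B₂ p.rep} = {v | 0 < B₁ v.1 * B₂ v.1} := by
    ext v
    obtain ⟨a, ha⟩ := Projectivization.exists_smul_eq_mk_rep ℝ v.1 v.2
    have ha' : (Projectivization.mk ℝ v.1 v.2).rep = (a : ℝ) • v.1 := ha.symm
    have hsq : 0 < (a : ℝ) * a := mul_self_pos.mpr a.ne_zero
    simp only [Set.mem_preimage, Set.mem_ofPred_eq, ha', map_smul, smul_eq_mul]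
    rw [show (a : ℝ) * B₁ v.1 * (a * B₂ v.1) = (a * a) * (B₁ v.1 * B₂ v.1) by ring,
      mul_pos_iff_of_pos_left hsq]
  rw [this]
  exact isOpen_lt continuous_const
    ((h1.comp continuous_subtype_val).mul (h2.comp continuous_subtype_val))

/-- The faces are the cells. -/
theorem connectedComponentIn_openStratum {q : QuadraticForm ℤ L}
    (h : IsLorentzian (realBilin q)) {S : Set L} {k : ℕ} {s : Fin k → L} (hs : ∀ i, s i ∈ S)
    (hli : LinearIndependent ℝ (fun i => ((1 : ℝ) ⊗ₜ[ℤ] s i : RealSpace L)))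
    {p : ℙ ℝ (RealSpace L)} (hp : p ∈ hypSubspace q (⨅ i, perp q (s i)) \
      ⋃ W' ∈ flats q S (k + 1), hypSubspace q W') :
    connectedComponentIn (hypSubspace q (⨅ i, perp q (s i)) \
      ⋃ W' ∈ flats q S (k + 1), hypSubspace q W') p = cell q S p.rep := by
  obtain ⟨hst, h0⟩ := (mem_openStratum_iff hs hli).mp hp
  refine Set.Subset.antisymm (fun y hy => ?_)
    ((isPreconnected_cell h hst.pos).subset_connectedComponentIn (rep_mem_cell hst.pos)
      fun y hy => ?_)
  · have hsub := connectedComponentIn_subset (hypSubspace q (⨅ i, perp q (s i)) \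
      ⋃ W' ∈ flats q S (k + 1), hypSubspace q W') p
    have hconn := isPreconnected_connectedComponentIn (x := p)
      (F := hypSubspace q (⨅ i, perp q (s i)) \ ⋃ W' ∈ flats q S (k + 1), hypSubspace q W')
    have hpC := mem_connectedComponentIn hp
    set C := connectedComponentIn (hypSubspace q (⨅ i, perp q (s i)) \
      ⋃ W' ∈ flats q S (k + 1), hypSubspace q W') p
    have hC : ∀ z ∈ C, OnStratum q S k z.rep ∧
        ∀ i, realBilin q ((1 : ℝ) ⊗ₜ[ℤ] s i) z.rep = 0 :=
      fun z hz => (mem_openStratum_iff hs hli).mp (hsub hz)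
    have hypos := (hC y hy).1.pos
    have hyp := h.ne_zero hst.pos hypos
    -- This scalar moves the representative of `y` into the half of the light cone containing that
    -- of `p`.
    refine ⟨hypos, realBilin q p.rep y.rep, ?_, fun t ht => ?_⟩
    · rw [map_smul, LinearMap.smul_apply, smul_eq_mul, h.symm y.rep]
      exact mul_self_pos.mpr hyp
    by_cases ht0 : realBilin q ((1 : ℝ) ⊗ₜ[ℤ] t) p.rep = 0
    · have hy0 : realBilin q ((1 : ℝ) ⊗ₜ[ℤ] t) y.rep = 0 :=
        ((hC y hy).1.eq_zero_iff hs hli (hC y hy).2 ht).mpr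
          ((hst.eq_zero_iff hs hli h0 ht).mp ht0)
      rw [sgn_eq_zero.mpr ht0, sgn_eq_zero, map_smul, hy0, smul_zero]
    have hz0 : ∀ z ∈ C, realBilin q ((1 : ℝ) ⊗ₜ[ℤ] t) z.rep ≠ 0 := fun z hz hzt =>
      ht0 ((hst.eq_zero_iff hs hli h0 ht).mpr
        (((hC z hz).1.eq_zero_iff hs hli (hC z hz).2 ht).mp hzt))
    -- Neither `f` nor pairing with `p` vanishes on `C`, so the two sign conditions on their product
    -- split `C` into disjoint relatively open parts; connectedness leaves only the part containing
    -- `p`.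
    have key : ∀ f : RealSpace L →ₗ[ℝ] ℝ, (∀ z ∈ C, f z.rep ≠ 0) → 0 < f p.rep →
        0 < realBilin q p.rep y.rep * f y.rep := by
      intro f hf hfp
      have hU := isOpen_pairing_pos (realBilin q p.rep) f
      have hU' := isOpen_pairing_pos (realBilin q p.rep) (-f)
      refine hconn.subset_left_of_subset_union hU hU' ?_ ?_ ?_ hy
      · rw [Set.disjoint_left]
        intro z hz hz'
        simp only [Set.mem_ofPred_eq, LinearMap.neg_apply] at hz hz'
        linarith
      · intro z hz
        simp only [Set.mem_union, Set.mem_ofPred_eq, LinearMap.neg_apply, mul_neg, neg_pos]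
        exact (mul_ne_zero (h.ne_zero hst.pos (hC z hz).1.pos) (hf z hz)).lt_or_gt.symm
      · exact ⟨p, hpC, mul_pos hst.pos hfp⟩
    simp only [sgn, map_smul, smul_eq_mul]
    rcases lt_or_gt_of_ne ht0 with hlt | hgt
    · have := key (-realBilin q ((1 : ℝ) ⊗ₜ[ℤ] t)) (fun z hz => by simpa using hz0 z hz)
        (by simpa using hlt)
      rw [sign_neg hlt, sign_neg (by simpa using this)]
    · rw [sign_pos hgt, sign_pos (key _ hz0 hgt)]
  · refine (mem_openStratum_iff hs hli).mpr ⟨hst.of_cell hy, fun i => ?_⟩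
    obtain ⟨-, c, hc⟩ := hy
    have := (hc.2 _ (hs i)).trans (sgn_eq_zero.mpr (h0 i))
    rw [sgn_eq_zero, map_smul, smul_eq_mul] at this
    exact (mul_eq_zero.mp this).resolve_left hc.left_ne_zero

theorem mem_faces_iff {q : QuadraticForm ℤ L} (h : IsLorentzian (realBilin q)) {S : Set L}
    {n d : ℕ} {F : Set (ℙ ℝ (RealSpace L))} :
    F ∈ faces q S n d ↔
      ∃ k, k + d = n ∧ ∃ p : ℙ ℝ (RealSpace L), OnStratum q S k p.rep ∧ F = cell q S p.rep := by
  constructor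
  · rintro ⟨k, hk, _, ⟨s, hs, hli, rfl⟩, p, hp, rfl⟩
    exact ⟨k, hk, p, ((mem_openStratum_iff hs hli).mp hp).1,
      connectedComponentIn_openStratum h hs hli hp⟩
  · rintro ⟨k, hk, p, hst, rfl⟩
    obtain ⟨s, hs, hli, h0⟩ := hst.exists_tuple
    have hp := (mem_openStratum_iff hs hli).mpr ⟨hst, h0⟩
    exact ⟨k, hk, _, ⟨s, hs, hli, rfl⟩, p, hp,
      (connectedComponentIn_openStratum h hs hli hp).symm⟩

theorem image_mem_faces {q : QuadraticForm ℤ L} (h : IsLorentzian (realBilin q))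
    {Γ : Subgroup (orthogonalGroup q)} {S : Set L}
    (hS : ∀ γ ∈ Γ, ∀ s ∈ S, (γ : L ≃ₗ[ℤ] L) s ∈ S) {n d : ℕ} {γ : orthogonalGroup q}
    (hγ : γ ∈ Γ) {F : Set (ℙ ℝ (RealSpace L))} (hF : F ∈ faces q S n d) :
    projAct (γ : L ≃ₗ[ℤ] L) '' F ∈ faces q S n d := by
  rw [mem_faces_iff h] at hF ⊢
  obtain ⟨k, hk, p, hst, rfl⟩ := hF
  have hmem : projAct (γ : L ≃ₗ[ℤ] L) p ∈ cell q S (realAct (γ : L ≃ₗ[ℤ] L) p.rep) :=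
    projAct_mem_cell (hS _ (Γ.inv_mem hγ)) (rep_mem_cell hst.pos)
  have hst' := hst.map hS hγ
  refine ⟨k, hk, projAct (γ : L ≃ₗ[ℤ] L) p, hst'.of_cell hmem, ?_⟩
  rw [image_cell hS hγ, cell_rep_eq h hst'.pos hmem]

/-! ### The orbit `Γ · S₀` and the conclusion. -/

theorem orbitSet_invariant {q : QuadraticForm ℤ L} (Γ : Subgroup (orthogonalGroup q))
    (S₀ : Set L) : ∀ γ ∈ Γ, ∀ s ∈ orbitSet Γ S₀, (γ : L ≃ₗ[ℤ] L) s ∈ orbitSet Γ S₀ := by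
  rintro γ hγ _ ⟨γ', hγ', s₀, hs₀, rfl⟩
  exact ⟨γ * γ', Γ.mul_mem hγ hγ', s₀, hs₀, rfl⟩

theorem exists_le_polar_orbitSet {q : QuadraticForm ℤ L} (Γ : Subgroup (orthogonalGroup q))
    {S₀ : Set L} (hfin : S₀.Finite) :
    ∃ N : ℤ, ∀ s ∈ orbitSet Γ S₀, -N ≤ q.polarBilin s s := by
  obtain ⟨N, hN⟩ := (hfin.image fun s => -q.polarBilin s s).bddAbove
  refine ⟨N, ?_⟩
  rintro _ ⟨γ, hγ, s₀, hs₀, rfl⟩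
  have h1 : q ((γ : L ≃ₗ[ℤ] L) s₀) = q s₀ := γ.2 s₀
  have h2 : -q.polarBilin s₀ s₀ ≤ N := hN ⟨s₀, hs₀, rfl⟩
  simp only [QuadraticMap.polarBilin_apply_apply, QuadraticMap.polar_self, h1] at h2 ⊢
  linarith

end HypTess

theorem mainTheorem12 {L : Type*} [AddCommGroup L] [Module.Free ℤ L] [Module.Finite ℤ L]
    (n : ℕ) (q : QuadraticForm ℤ L) (hq : HypTess.HasSignature q 1 n)
    (Γ : Subgroup (HypTess.orthogonalGroup q)) (hΓ : Γ.FiniteIndex)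
    (S₀ : Set L) (hfin : S₀.Finite) (hneg : ∀ s ∈ S₀, q s < 0) (d : ℕ) :
    -- `Γ` maps `d`-dimensional faces to `d`-dimensional faces
    (∀ γ ∈ Γ, ∀ F ∈ HypTess.faces q (HypTess.orbitSet Γ S₀) n d,
      HypTess.projAct (γ : L ≃ₗ[ℤ] L) '' F ∈ HypTess.faces q (HypTess.orbitSet Γ S₀) n d) ∧
    -- and finitely many faces represent all orbits
    ∃ T : Set (Set (Projectivization ℝ (HypTess.RealSpace L))),
      T.Finite ∧ T ⊆ HypTess.faces q (HypTess.orbitSet Γ S₀) n d ∧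
      ∀ F ∈ HypTess.faces q (HypTess.orbitSet Γ S₀) n d,
        ∃ F' ∈ T, ∃ γ ∈ Γ, F = HypTess.projAct (γ : L ≃ₗ[ℤ] L) '' F' := by
  have h := hq.isLorentzian
  have hS := HypTess.orbitSet_invariant Γ S₀
  obtain ⟨N, hN⟩ := HypTess.exists_le_polar_orbitSet Γ hfin
  set S := HypTess.orbitSet Γ S₀
  have himage : ∀ γ ∈ Γ, ∀ F ∈ HypTess.faces q S n d,
      HypTess.projAct (γ : L ≃ₗ[ℤ] L) '' F ∈ HypTess.faces q S n d :=
    fun γ hγ F hF => HypTess.image_mem_faces h hS hγ hF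
  refine ⟨himage, ?_⟩
  obtain ⟨T, hT, hpos, hrep⟩ := HypTess.exists_finite_cells h hΓ hS hN
  -- `T` represents cells of every dimension, hence the intersection. The representative of a face
  -- `F` survives it, being the translate `γ⁻¹ F`.
  refine ⟨HypTess.cell q S '' T ∩ HypTess.faces q S n d, (hT.image _).inter_of_left _,
    Set.inter_subset_right, fun F hF => ?_⟩
  obtain ⟨k, hk, p, hst, hFp⟩ := (HypTess.mem_faces_iff h).mp hF
  obtain ⟨t, ht, γ, hγ, hcell⟩ := hrep p.rep hst.pos
  have hFt : F = HypTess.projAct (γ : L ≃ₗ[ℤ] L) '' HypTess.cell q S t := by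
    rw [HypTess.image_cell hS hγ, hFp]
    refine HypTess.cell_eq_of_sameCell h hst.pos ?_ hcell
    rw [HypTess.realBilin_realAct γ.2]
    exact hpos t ht
  refine ⟨HypTess.cell q S t, ⟨⟨t, ht, rfl⟩, ?_⟩, γ, hγ, hFt⟩
  have hmem := himage γ⁻¹ (Γ.inv_mem hγ) F hF
  have hinv := HypTess.realAct_realAct_inv γ⁻¹ t
  rw [inv_inv] at hinv
  rwa [hFt, HypTess.image_cell hS hγ, HypTess.image_cell hS (Γ.inv_mem hγ), hinv] at hmem
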